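/- **Theorem A.** Work in $\mathbb R^d$ with the lattice $\mathbb Z^d$ and standard basis $e_0,\dots,e_{d-1}$. A lattice polytope is a polytope all of whose vertices lie in $\mathbb Z^d$. A lattice polytope $P\subset\mathbb R^d$ with $0$ in its interior is *reflexive* if its dual $P^*=\{x\in\mathbb R^d:\langle y,x\rangle\ge -1\ \text{for all } y\in P\}$ is also a lattice polytope. The *normalized volume* $\mathrm{Vol}(P)$ is $d!$ times the Euclidean volume, and $P\cong P'$ means that some linear automorphism of $\mathbb R^d$ that maps $\mathbb Z^d$ onto itself maps $P$ onto $P'$. Let $y_0=2$, $y_n=1+y_0\cdots y_{n-1}$ for $n\ge 1$ (the Sylvester sequence), $t_n=y_n-1$, and, for $d\ge 2$, $$Q'_d=\Big(\frac{2t_{d-1}}{y_0},\dots,\frac{2t_{d-1}}{y_{d-2}},1,1\Big).$$ For a tuple $Q=(q_0,\dots,q_d)$ of positive integers with $q_d=1$ such that every $k_i:=(q_0+\cdots+q_d)/q_i$ is an integer, put $$S_Q=\mathrm{conv}(k_0e_0-u,\dots,k_{d-1}e_{d-1}-u,-u),\qquad u=e_0+\cdots+e_{d-1}.$$ 1. $S_{(1,1,1)}$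 is a reflexive simplex. Every two-dimensional reflexive simplex $P$ satisfies $\mathrm{Vol}(P)\le 9$ and $|P\cap\mathbb Z^2|\le 10$, and in each of the two inequalities equality holds if and only if $P\cong S_{(1,1,1)}$. 2. $S_{(3,1,1,1)}$ and $S_{Q'_3}$ are reflexive simplices. Every three-dimensional reflexive simplex $P$ satisfies $\mathrm{Vol}(P)\le 72$ and $|P\cap\mathbb Z^3|\le 39$, and in each of the two inequalities equality holds if and only if $P\cong S_{(3,1,1,1)}$ or $P\cong S_{Q'_3}$. 3. Let $d\ge 4$. Then $S_{Q'_d}$ is a reflexive simplex. Every $d$-dimensional reflexive simplex $P$ satisfies $\mathrm{Vol}(P)\le 2t_{d-1}^2$, with equality if and only if $P\cong S_{Q'_d}$. -/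

import Mathlib

/-- The lattice points of `ℝ^d`: the standard lattice `ℤ^d`. -/
def latticePts (d : ℕ) : Set (Fin d → ℝ) :=
  Set.range fun (z : Fin d → ℤ) (i : Fin d) => (z i : ℝ)

/-- A polytope is the convex hull of a finite set of points; it is a lattice polytope if all of its
vertices (extreme points) are lattice points. -/
def IsLatticePolytope {d : ℕ} (P : Set (Fin d → ℝ)) : Prop :=
  (∃ s : Set (Fin d → ℝ), s.Finite ∧ P = convexHull ℝ s) ∧ P.extremePoints ℝ ⊆ latticePts d

/-- The dual `P^* = {x : ⟨y, x⟩ ≥ -1 for all y ∈ P}`; the dual lattice of `ℤ^d` is identified with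
`ℤ^d` through the standard pairing. -/
def dualPolytope {d : ℕ} (P : Set (Fin d → ℝ)) : Set (Fin d → ℝ) :=
  {x | ∀ y ∈ P, -1 ≤ y ⬝ᵥ x}

/-- Reflexive polytopes. Having the origin as an interior point forces dimension `d`. -/
def IsReflexive {d : ℕ} (P : Set (Fin d → ℝ)) : Prop :=
  IsLatticePolytope P ∧ (0 : Fin d → ℝ) ∈ interior P ∧ IsLatticePolytope (dualPolytope P)

/-- A `d`-dimensional simplex in `ℝ^d`: the convex hull of `d + 1` affinely independent points. -/
def IsSimplex {d : ℕ} (P : Set (Fin d → ℝ)) : Prop :=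
  ∃ v : Fin (d + 1) → Fin d → ℝ, AffineIndependent ℝ v ∧ P = convexHull ℝ (Set.range v)

/-- A `d`-dimensional reflexive simplex. -/
def IsReflexiveSimplex {d : ℕ} (P : Set (Fin d → ℝ)) : Prop :=
  IsReflexive P ∧ IsSimplex P

/-- Unimodular equivalence of `d`-dimensional polytopes: an isomorphism of the lattice `ℤ^d`,
extended linearly to `ℝ^d`, maps `P₁` onto `P₂` (and hence faces onto faces). -/
def UnimodularlyEquivalent {d : ℕ} (P₁ P₂ : Set (Fin d → ℝ)) : Prop :=
  ∃ f : (Fin d → ℝ) ≃ₗ[ℝ] (Fin d → ℝ), f '' latticePts d = latticePts d ∧ f '' P₁ = P₂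

/-- The normalized volume: `d!` times the Lebesgue measure. -/
noncomputable def normalizedVolume {d : ℕ} (P : Set (Fin d → ℝ)) : ℝ :=
  (d.factorial : ℝ) * (MeasureTheory.volume P).toReal

/-- The number of lattice points of `P` (finite when `P` is bounded). -/
noncomputable def numLatticePts {d : ℕ} (P : Set (Fin d → ℝ)) : ℕ :=
  (P ∩ latticePts d).ncard

/-- The Sylvester sequence `y_0 = 2`, `y_{n+1} = y_n (y_n - 1) + 1`. -/
def sylvesterSeq : ℕ → ℕ
  | 0 => 2
  | n + 1 => sylvesterSeq n * (sylvesterSeq n - 1) + 1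

/-- `t_n = y_n - 1`. -/
def sylvesterT (n : ℕ) : ℕ := sylvesterSeq n - 1

/-- The usual description of the Sylvester sequence, `y_n = 1 + y_0 ⋯ y_{n-1}`. -/
theorem sylvesterSeq_eq_one_add_prod (n : ℕ) :
    sylvesterSeq n = 1 + ∏ i ∈ Finset.range n, sylvesterSeq i := by
  induction n with
  | zero => rfl
  | succ n ih =>
    rw [Finset.prod_range_succ, sylvesterSeq]
    have h : sylvesterSeq n - 1 = ∏ i ∈ Finset.range n, sylvesterSeq i := by omega
    rw [h]
    ring

/-- `y_i` divides `t_n` for `i < n`, so the divisions in `enlargedSylvester` are exact. -/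
theorem sylvesterSeq_dvd_sylvesterT {i n : ℕ} (h : i < n) :
    sylvesterSeq i ∣ sylvesterT n := by
  rw [sylvesterT, sylvesterSeq_eq_one_add_prod n, Nat.add_sub_cancel_left]
  exact Finset.dvd_prod_of_mem _ (Finset.mem_range.mpr h)

/-- The enlarged Sylvester weight system
`Q'_d = (2 t_{d-1} / y_0, …, 2 t_{d-1} / y_{d-2}, 1, 1)`, of `d + 1` entries, for `d ≥ 1`. -/
def enlargedSylvester (d : ℕ) (i : Fin (d + 1)) : ℕ :=
  if (i : ℕ) < d - 1 then 2 * sylvesterT (d - 1) / sylvesterSeq i else 1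

/-- For `Q = (q_0, …, q_d)` with total weight `|Q| = q_0 + ⋯ + q_d`, `q_d = 1` and
`k_i = |Q| / q_i`, the set `S_Q = conv(k_0 e_0 - u, …, k_{d-1} e_{d-1} - u, -u)`, where
`u = e_0 + ⋯ + e_{d-1}` is the all-ones vector. -/
def weightSimplex {d : ℕ} (Q : Fin (d + 1) → ℕ) : Set (Fin d → ℝ) :=
  convexHull ℝ (insert (-1) (Set.range fun i : Fin d =>
    (((∑ j, Q j : ℕ) : ℝ) / (Q i.castSucc : ℝ)) • Pi.single i (1 : ℝ) - 1))

/-! ### The product of a unit partition -/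

/-! Let `v_j` be the vertices of a reflexive simplex `P` and `w_i` those of its dual, `w_i`
belonging to the facet opposite to `v_i`. Then `⟨w_i, v_j⟩ = -1` for `i ≠ j` and `⟨w_i, v_i⟩ = k_i -
1`, where the `1 / k_i` are the barycentric coordinates of the origin. So the `k_i` are positive
integers with `∑ 1 / k_i = 1`. The integer matrix of the `w_i`, `i < d`, times the transposed matrix
of the edges at `v_d` is `diag(k_0, …, k_{d-1})`. Hence `Vol(P)` divides `k_0 ⋯ k_{d-1}`; if they
are equal, the matrix of the `w_i` is unimodular and carries `P` onto the simplex with vertices `k_i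
e_i - u` and `-u`.

With the largest `k_i` placed last, a question on unit partitions remains
(`prod_castSucc_le_of_sum_inv_eq_one`). Integrality enters its bound only through `∏_{i<l} 1 / k_i ≤
1 - ∑_{i<l} 1 / k_i`. Under these constraints the real minimum of the product of all but the last
term (`inv_le_prod_of_prefix_le`) is attained only by sequences of `l` Sylvester reciprocals
followed by a constant. The resulting `sylvesterValue d l` is largest at `l = d - 1` alone for `d ≥
4`, at `l = 1, 2` for `d = 3`, and at `l = 0` for `d = 2`.

Lattice points are counted in the quotient of `ℤ^d` by the edge lattice, a group of order `Vol(P)`.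
The sum of the fractional parts of the `⟨w_i, z⟩ / k_i` is a height on this group. After subtraction
of `v_d`, the non-vertices of `P` give distinct classes of height `1`; a reflection gives as many of
height `d - 1`; `0` and `v_d` have heights `0` and `d`. This bounds the number of lattice points by
`Vol(P) + 1` for `d = 2` and by `Vol(P) / 2 + 3` for `d = 3`, so the extremal cases are those of the
volume. -/

theorem sylvesterSeq_pos (n : ℕ) : 2 ≤ sylvesterSeq n := by
  induction n with
  | zero => simp [sylvesterSeq]
  | succ n ih =>
    rw [sylvesterSeq]
    nlinarith [Nat.mul_le_mul ih (Nat.le_sub_one_of_lt ih)]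

theorem sylvesterSeq_eq_sylvesterT_add_one (n : ℕ) : sylvesterSeq n = sylvesterT n + 1 := by
  have := sylvesterSeq_pos n
  unfold sylvesterT
  omega

theorem sylvesterT_pos (n : ℕ) : 0 < sylvesterT n := by
  have := sylvesterSeq_pos n
  unfold sylvesterT
  omega

theorem sylvesterT_zero : sylvesterT 0 = 1 := rfl

theorem sylvesterT_succ (n : ℕ) :
    sylvesterT (n + 1) = sylvesterT n * (sylvesterT n + 1) := by
  have h := sylvesterSeq_eq_sylvesterT_add_one n
  rw [sylvesterT, sylvesterSeq, h]
  simp [mul_comm]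

/-- The product of the first `d` denominators of the unit partition
`1 / y_0 + ⋯ + 1 / y_{l-1} + (d - l + 1) * (1 / ((d - l + 1) t_l)) = 1`, times `t_l`. -/
def sylvesterValue (d l : ℕ) : ℕ := (d - l + 1) ^ (d - l) * sylvesterT l ^ (d - l + 1)

theorem sylvesterValue_pos (d l : ℕ) : 0 < sylvesterValue d l := by
  have := sylvesterT_pos l
  unfold sylvesterValue
  positivity

/-- Lowering the terms above a level `L` to `L` and giving the excess to a larger number lowers
the product. -/
theorem truncate_mul_prod_le {a L : ℝ} (hL : 0 < L) (hLa : L ≤ a) (f : ℕ → ℝ) (n : ℕ)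
    (hf : ∀ i < n, 0 < f i) (hfa : ∀ i < n, f i ≤ a) :
    (a + ∑ i ∈ Finset.range n, (f i - min (f i) L)) * ∏ i ∈ Finset.range n, min (f i) L ≤
        a * ∏ i ∈ Finset.range n, f i ∧
      ((a + ∑ i ∈ Finset.range n, (f i - min (f i) L)) * ∏ i ∈ Finset.range n, min (f i) L =
        a * ∏ i ∈ Finset.range n, f i → ∀ i < n, f i ≤ L) := by
  induction n with
  | zero => simp
  | succ n ih =>
    obtain ⟨ih1, ih2⟩ := ih (fun i hi => hf i (by omega)) (fun i hi => hfa i (by omega))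
    rw [Finset.sum_range_succ, Finset.prod_range_succ, Finset.prod_range_succ]
    set S := ∑ i ∈ Finset.range n, (f i - min (f i) L) with hS
    set p := ∏ i ∈ Finset.range n, min (f i) L with hp
    set q := ∏ i ∈ Finset.range n, f i with hq
    have hS0 : 0 ≤ S := Finset.sum_nonneg fun i _ => sub_nonneg.2 (min_le_left _ _)
    have hp0 : 0 < p := Finset.prod_pos fun i hi =>
      lt_min (hf i (by have := Finset.mem_range.1 hi; omega)) hL
    have hfn := hf n (by omega)
    have hfan := hfa n (by omega)
    set m := min (f n) L with hm
    have hmL : m ≤ L := min_le_right _ _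
    have hmf : m ≤ f n := min_le_left _ _
    -- The difference of the two sides is `(f n - m) * (a + S - m)`, and `m ≤ L ≤ a`.
    have h1 : (a + (S + (f n - m))) * m ≤ (a + S) * f n := by nlinarith
    have h2 : (a + (S + (f n - m))) * (p * m) ≤ (a + S) * p * f n := by nlinarith
    have h3 : (a + S) * p * f n ≤ a * (q * f n) := by nlinarith
    refine ⟨h2.trans h3, fun h i hi => ?_⟩
    have h4 : (a + S) * p * f n = a * (q * f n) := le_antisymm h3 (h ▸ h2)
    have h5 : (a + S) * p = a * q := by
      have : (a + S) * p * f n = a * q * f n := by rw [h4]; ring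
      exact mul_right_cancel₀ hfn.ne' this
    rcases Nat.lt_succ_iff_lt_or_eq.1 hi with hi | rfl
    · exact ih2 h5 i hi
    · by_contra hlt
      push Not at hlt
      have hmeq : m = L := min_eq_right hlt.le
      have h6 : (a + (S + (f i - m))) * m < (a + S) * f i := by
        rw [hmeq]
        have : L < a := hlt.trans_le hfan
        nlinarith [mul_pos (sub_pos.2 hlt) (sub_pos.2 this), mul_nonneg hS0 (sub_pos.2 hlt).le]
      have h7 : (a + (S + (f i - m))) * (p * m) < (a + S) * p * f i := by nlinarith
      linarith

/-- The function `z * ((s - z) / n) ^ m` exceeds on an interval the smaller of its values at the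
end points. -/
theorem lt_mul_pow_of_mem_Ioo {s a b z c n : ℝ} (m : ℕ) (ha : 0 < a) (hz : a < z) (hzb : z < b)
    (hb : b < s) (hn : 0 < n) (hca : c ≤ a * ((s - a) / n) ^ m)
    (hcb : c ≤ b * ((s - b) / n) ^ m) : c < z * ((s - z) / n) ^ m := by
  -- The logarithm of the function is strictly concave. Strictness comes from `log z` alone, so `m =
  -- 0` is allowed.
  have hconc : StrictConcaveOn ℝ (Set.Ioo 0 s)
      (fun z : ℝ => Real.log z + m * Real.log ((s - z) / n)) := by
    have h1 : StrictConcaveOn ℝ (Set.Ioo 0 s) Real.log :=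
      strictConcaveOn_log_Ioi.subset (fun x hx => hx.1) (convex_Ioo 0 s)
    have h2 : ConcaveOn ℝ (Set.Ioo 0 s) (fun z : ℝ => (m : ℝ) * Real.log ((s - z) / n)) := by
      refine ⟨convex_Ioo 0 s, fun x hx y hy p q hp hq hpq => ?_⟩
      have := strictConcaveOn_log_Ioi.concaveOn.2
        (show (s - x) / n ∈ Set.Ioi 0 from div_pos (sub_pos.2 hx.2) hn)
        (show (s - y) / n ∈ Set.Ioi 0 from div_pos (sub_pos.2 hy.2) hn) hp hq hpq
      have he : p • ((s - x) / n) + q • ((s - y) / n) = (s - (p • x + q • y)) / n := by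
        simp only [smul_eq_mul]
        have : s = (p + q) * s := by rw [hpq, one_mul]
        rw [this]
        field_simp
        ring_nf
        rw [show q = 1 - p by linarith]
        ring
      rw [he] at this
      simp only [smul_eq_mul] at this ⊢
      nlinarith [mul_le_mul_of_nonneg_left this (Nat.cast_nonneg (α := ℝ) m)]
    exact h1.add_concaveOn h2
  have key := hconc.lt_on_openSegment (x := a) (y := b) (z := z) ⟨ha, by linarith⟩
    ⟨by linarith, hb⟩ (by linarith) (by rw [openSegment_eq_Ioo (by linarith)]; exact ⟨hz, hzb⟩)
  have hexp : ∀ x : ℝ, 0 < x → x < s →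
      Real.log x + m * Real.log ((s - x) / n) = Real.log (x * ((s - x) / n) ^ m) := by
    intro x hx hxs
    have : 0 < (s - x) / n := div_pos (sub_pos.2 hxs) hn
    rw [Real.log_mul hx.ne' (pow_pos this m).ne', Real.log_pow]
  have hpos : ∀ x : ℝ, 0 < x → x < s → 0 < x * ((s - x) / n) ^ m := by
    intro x hx hxs
    have : 0 < (s - x) / n := div_pos (sub_pos.2 hxs) hn
    positivity
  simp only [hexp a ha (by linarith), hexp b (by linarith) hb,
    hexp z (by linarith) (by linarith)] at key
  rcases min_lt_iff.1 key with h | h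
  · exact hca.trans_lt ((Real.log_lt_log_iff (hpos a ha (by linarith))
      (hpos z (by linarith) (by linarith))).1 h)
  · exact hcb.trans_lt ((Real.log_lt_log_iff (hpos b (by linarith) hb)
      (hpos z (by linarith) (by linarith))).1 h)

/-- A lower bound for `s * x_0 ⋯ x_{n-1}`, where `s = 1 / t_j = x_0 + ⋯ + x_n`, over the antitone
positive sequences all of whose prefix products are bounded by the remaining sum. -/
theorem inv_le_prod_of_prefix_le {d M : ℕ} (hM : ∀ l ≤ d, sylvesterValue d l ≤ M) (n : ℕ) :
    ∀ (j : ℕ) (x : ℕ → ℝ), j + n = d → (∀ i ≤ n, 0 < x i) → (∀ i < n, x (i + 1) ≤ x i) →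
      ∑ i ∈ Finset.range (n + 1), x i = 1 / sylvesterT j →
      (∀ l ≤ n, 1 / (sylvesterT j : ℝ) * ∏ i ∈ Finset.range l, x i ≤
        1 / sylvesterT j - ∑ i ∈ Finset.range l, x i) →
      1 / (M : ℝ) ≤ 1 / sylvesterT j * ∏ i ∈ Finset.range n, x i ∧
      (1 / (M : ℝ) = 1 / sylvesterT j * ∏ i ∈ Finset.range n, x i →
        ∃ l, j ≤ l ∧ l ≤ d ∧ sylvesterValue d l = M ∧
          (∀ i, j + i < l → x i = 1 / sylvesterSeq (j + i)) ∧
          ∀ i, l ≤ j + i → i ≤ n → x i = 1 / (((d - l : ℕ) + 1) * sylvesterT l)) := by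
  induction n with
  | zero =>
    intro j x hj hpos _ hsum _
    obtain rfl : j = d := by omega
    have ht : (0 : ℝ) < sylvesterT j := Nat.cast_pos.2 (sylvesterT_pos j)
    have hv : sylvesterValue j j = sylvesterT j := by simp [sylvesterValue]
    have hMj := hM j le_rfl
    rw [hv] at hMj
    have hMj' : (sylvesterT j : ℝ) ≤ M := Nat.cast_le.2 hMj
    simp only [Finset.range_zero, Finset.prod_empty, mul_one]
    refine ⟨one_div_le_one_div_of_le ht hMj', fun h => ⟨j, le_rfl, le_rfl, ?_, ?_, ?_⟩⟩
    · rw [hv]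
      have := one_div_le_one_div (ht.trans_le hMj') ht
      have h' : (M : ℝ) ≤ sylvesterT j := by
        rw [← one_div_le_one_div ht (ht.trans_le hMj')]; exact h.ge
      exact le_antisymm hMj (by exact_mod_cast h')
    · intro i hi; omega
    · intro i _ hi
      obtain rfl : i = 0 := by omega
      simpa using hsum
  -- Lower the level `L` from `x 0` to the last term `f m`, cutting the tail at `L` and adding the
  -- excess to `x 0`; the product can only drop. Either the first term reaches its upper bound `1 /
  -- (t + 1) = 1 / y_j`, and induction applies to the cut tail, or the tail becomes constant before
  -- that and one variable remains.
  | succ m ih =>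
    intro j x hj hpos hanti hsum hcon
    set t : ℝ := (sylvesterT j : ℝ) with ht_def
    have ht1 : (1 : ℝ) ≤ t := by
      have := sylvesterT_pos j
      rw [ht_def]
      exact_mod_cast this
    have ht : 0 < t := by linarith
    have htsucc : (sylvesterT (j + 1) : ℝ) = t * (t + 1) := by
      rw [sylvesterT_succ]; push_cast; rfl
    have hM0 : (0 : ℝ) < M := Nat.cast_pos.2 ((sylvesterValue_pos d d).trans_le (hM d le_rfl))
    -- the tail
    set f : ℕ → ℝ := fun i => x (i + 1) with hf
    have hfpos : ∀ i ≤ m, 0 < f i := fun i hi => hpos _ (by omega)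
    have hanti' : ∀ i k, i ≤ k → k ≤ m + 1 → x k ≤ x i := by
      intro i k hik
      induction k, hik using Nat.le_induction with
      | base => intro _; exact le_rfl
      | succ k hik ih => exact fun hk => (hanti k (by omega)).trans (ih (by omega))
    have hsum' : x 0 + ∑ i ∈ Finset.range (m + 1), f i = 1 / t := by
      rw [← hsum, Finset.sum_range_succ' _ (m + 1)]
      ring
    have hprodsucc : ∀ l, ∏ i ∈ Finset.range (l + 1), x i = x 0 * ∏ i ∈ Finset.range l, f i := by
      intro l
      rw [Finset.prod_range_succ', mul_comm]
    have hsumsucc : ∀ l, ∑ i ∈ Finset.range (l + 1), x i = x 0 + ∑ i ∈ Finset.range l, f i := by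
      intro l
      rw [Finset.sum_range_succ', add_comm]
    -- the truncation at the level `L`
    let excess : ℝ → ℝ := fun L => ∑ i ∈ Finset.range (m + 1), (f i - min (f i) L)
    have hexcess_cont : Continuous excess := by
      simp only [excess]
      fun_prop
    have hexcess_top : x 0 + excess (x 0) = x 0 := by
      have : excess (x 0) = 0 := Finset.sum_eq_zero fun i hi => by
        rw [min_eq_left (hanti' 0 (i + 1) (by omega) (by have := Finset.mem_range.1 hi; omega)),
          sub_self]
      rw [this, add_zero]
    -- The constraint for `l = 1` reads `x 0 / t ≤ 1 / t - x 0`.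
    have hx0 : x 0 ≤ 1 / (t + 1) := by
      have := hcon 1 (by omega)
      simp only [Finset.prod_range_one, Finset.sum_range_one] at this
      rw [le_div_iff₀ (by linarith)]
      have h2 : t * (1 / t * x 0) ≤ t * (1 / t - x 0) := mul_le_mul_of_nonneg_left this ht.le
      have h3 : t * (1 / t * x 0) = x 0 := by field_simp
      have h4 : t * (1 / t - x 0) = 1 - t * x 0 := by field_simp
      linarith
    have htrunc : ∀ L, f m ≤ L → L ≤ x 0 →
        (x 0 + excess L) * ∏ i ∈ Finset.range m, min (f i) L ≤ x 0 * ∏ i ∈ Finset.range m, f i ∧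
        ((x 0 + excess L) * ∏ i ∈ Finset.range m, min (f i) L = x 0 * ∏ i ∈ Finset.range m, f i →
          ∀ i ≤ m, f i ≤ L) := by
      intro L hmL hL0
      have he : excess L = ∑ i ∈ Finset.range m, (f i - min (f i) L) := by
        simp only [excess]
        rw [Finset.sum_range_succ, min_eq_left hmL, sub_self, add_zero]
      rw [he]
      have := truncate_mul_prod_le ((hfpos m le_rfl).trans_le hmL) hL0 f m
        (fun i hi => hfpos i hi.le) (fun i hi => hanti' 0 (i + 1) (by omega) (by omega))
      refine ⟨this.1, fun h i hi => ?_⟩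
      rcases hi.lt_or_eq with hi | rfl
      · exact this.2 h i hi
      · exact hmL
    have hfm0 : f m ≤ x 0 := hanti' 0 (m + 1) (by omega) le_rfl
    rw [hprodsucc m]
    -- Once the first term is `1 / (t + 1)`, the prefactor and the remaining sum are again equal,
    -- both being `1 / t_{j+1}`; this closes the induction.
    have hs'eq : 1 / t * (1 / (t + 1)) = 1 / (sylvesterT (j + 1) : ℝ) := by
      rw [htsucc]; field_simp
    have hsx : 1 / t - 1 / (t + 1) = 1 / (sylvesterT (j + 1) : ℝ) := by
      rw [htsucc]; field_simp; ring
    by_cases hcase : 1 / (t + 1) ≤ x 0 + excess (f m)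
    · -- some truncation makes the first constraint tight
      obtain ⟨L, hLmem, hL⟩ : 1 / (t + 1) ∈ (fun L => x 0 + excess L) '' Set.Icc (f m) (x 0) := by
        refine intermediate_value_Icc' hfm0 (by fun_prop) ⟨?_, hcase⟩
        simpa only [hexcess_top] using hx0
      simp only at hL
      have hL0 : 0 < L := (hfpos m le_rfl).trans_le hLmem.1
      set g : ℕ → ℝ := fun i => min (f i) L with hg
      have hgpos : ∀ i ≤ m, 0 < g i := fun i hi => lt_min (hfpos i hi) hL0
      have hgsum : ∑ i ∈ Finset.range (m + 1), g i = 1 / sylvesterT (j + 1) := by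
        have : excess L = ∑ i ∈ Finset.range (m + 1), f i - ∑ i ∈ Finset.range (m + 1), g i := by
          simp only [excess]
          rw [Finset.sum_sub_distrib]
        rw [← hsx]
        linarith
      have hgcon : ∀ l ≤ m, 1 / (sylvesterT (j + 1) : ℝ) * ∏ i ∈ Finset.range l, g i ≤
          1 / sylvesterT (j + 1) - ∑ i ∈ Finset.range l, g i := by
        intro l hl
        have hsplit : 1 / (sylvesterT (j + 1) : ℝ) - ∑ i ∈ Finset.range l, g i =
            ∑ i ∈ Finset.Ico l (m + 1), g i := by
          rw [← hgsum, ← Finset.sum_range_add_sum_Ico g (show l ≤ m + 1 by omega)]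
          ring
        rw [hsplit]
        -- If `f l < L`, the terms from `l` on are uncut: the right side is that of the old
        -- constraint for `l + 1`, and the left side is no larger, by `truncate_mul_prod_le` on the
        -- first `l` terms.
        rcases lt_or_ge (f l) L with hlt | hge
        · have h1 : ∑ i ∈ Finset.Ico l (m + 1), g i = ∑ i ∈ Finset.Ico l (m + 1), f i := by
            refine Finset.sum_congr rfl fun i hi => ?_
            have hi := Finset.mem_Ico.1 hi
            exact min_eq_left ((hanti' (l + 1) (i + 1) (by omega) (by omega)).trans hlt.le)
          have h2 := hcon (l + 1) (by omega)
          rw [hprodsucc, hsumsucc] at h2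
          have h3 : 1 / t - (x 0 + ∑ i ∈ Finset.range l, f i) =
              ∑ i ∈ Finset.Ico l (m + 1), f i := by
            rw [← hsum', ← Finset.sum_range_add_sum_Ico f (show l ≤ m + 1 by omega)]
            ring
          rw [h1, ← h3]
          refine le_trans ?_ h2
          have h4 := (truncate_mul_prod_le hL0 hLmem.2 f l
            (fun i hi => hfpos i (by omega))
            (fun i hi => hanti' 0 (i + 1) (by omega) (by omega))).1
          have h5 : excess L = ∑ i ∈ Finset.range l, (f i - min (f i) L) := by
            simp only [excess]
            rw [← Finset.sum_range_add_sum_Ico _ (show l ≤ m + 1 by omega)]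
            rw [add_eq_left]
            refine Finset.sum_eq_zero fun i hi => ?_
            have hi := Finset.mem_Ico.1 hi
            rw [min_eq_left ((hanti' (l + 1) (i + 1) (by omega) (by omega)).trans hlt.le),
              sub_self]
          rw [← h5, hL] at h4
          rw [← hs'eq, mul_assoc]
          exact mul_le_mul_of_nonneg_left h4 (by positivity)
        -- Here the right side contains the term `g l = L`. For `l > 0` the last factor on the left
        -- is at most `L` and the others are at most `1`.
        · have h1 : L ≤ ∑ i ∈ Finset.Ico l (m + 1), g i := by
            have : g l ≤ ∑ i ∈ Finset.Ico l (m + 1), g i :=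
              Finset.single_le_sum (f := g)
                (fun i hi => (hgpos i (by have := Finset.mem_Ico.1 hi; omega)).le)
                (Finset.mem_Ico.2 ⟨le_rfl, by omega⟩)
            rwa [show g l = L from min_eq_right hge] at this
          have hs1 : 1 / (sylvesterT (j + 1) : ℝ) ≤ 1 := by
            rw [htsucc, div_le_one (by positivity)]
            nlinarith
          have hs0 : 0 < 1 / (sylvesterT (j + 1) : ℝ) := by
            rw [htsucc]; positivity
          rcases Nat.eq_zero_or_pos l with rfl | hlpos
          · rw [← hsplit]
            simp
          · refine le_trans ?_ h1
            obtain ⟨l, rfl⟩ : ∃ l', l = l' + 1 := ⟨l - 1, by omega⟩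
            rw [Finset.prod_range_succ]
            have h2 : ∏ i ∈ Finset.range l, g i ≤ 1 := by
              refine Finset.prod_le_one
                (fun i hi => (hgpos i (by have := Finset.mem_range.1 hi; omega)).le)
                (fun i hi => ?_)
              have hi := Finset.mem_range.1 hi
              have : g i ≤ 1 / (sylvesterT (j + 1) : ℝ) := by
                rw [← hgsum]
                exact Finset.single_le_sum (f := g)
                  (fun i hi => (hgpos i (by have := Finset.mem_range.1 hi; omega)).le)
                  (Finset.mem_range.2 (by omega))
              linarith
            have h3 : 0 ≤ ∏ i ∈ Finset.range l, g i := Finset.prod_nonneg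
              fun i hi => (hgpos i (by have := Finset.mem_range.1 hi; omega)).le
            have h4 : g l ≤ L := min_le_right _ _
            have h5 := hgpos l (by omega)
            calc _ ≤ 1 * (1 * L) := by gcongr
              _ = L := by ring
      obtain ⟨ih1, ih2⟩ := ih (j + 1) g (by omega) hgpos
        (fun i hi => min_le_min_right _ (hanti (i + 1) (by omega))) hgsum hgcon
      obtain ⟨ht1, ht2⟩ := htrunc L hLmem.1 hLmem.2
      rw [hL] at ht1 ht2
      have hchain : 1 / (sylvesterT (j + 1) : ℝ) * ∏ i ∈ Finset.range m, g i ≤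
          1 / t * (x 0 * ∏ i ∈ Finset.range m, f i) := by
        rw [← hs'eq, mul_assoc]
        exact mul_le_mul_of_nonneg_left ht1 (by positivity)
      refine ⟨ih1.trans hchain, fun heq => ?_⟩
      have heq1 : 1 / (M : ℝ) = 1 / (sylvesterT (j + 1) : ℝ) * ∏ i ∈ Finset.range m, g i :=
        le_antisymm ih1 (heq ▸ hchain)
      have heq2 : 1 / (t + 1) * ∏ i ∈ Finset.range m, g i = x 0 * ∏ i ∈ Finset.range m, f i := by
        rw [heq1, ← hs'eq, mul_assoc] at heq
        exact mul_left_cancel₀ (by positivity) heq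
      -- Equality leaves nothing to cut, so `x 0 = 1 / (t + 1)` and the tail itself is extremal.
      have hfL := ht2 heq2
      have hgf : ∀ i ≤ m, g i = f i := fun i hi => min_eq_left (hfL i hi)
      have hx0eq : x 0 = 1 / (t + 1) := by
        have : excess L = 0 := Finset.sum_eq_zero fun i hi => by
          rw [min_eq_left (hfL i (by have := Finset.mem_range.1 hi; omega)), sub_self]
        rw [← hL, this, add_zero]
      obtain ⟨l, hl1, hl2, hl3, hl4, hl5⟩ := ih2 heq1
      refine ⟨l, by omega, hl2, hl3, fun i hi => ?_, fun i hi him => ?_⟩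
      · rcases i with _ | i
        · rw [hx0eq, add_zero, sylvesterSeq_eq_sylvesterT_add_one]
          push_cast
          rfl
        · have := hl4 i (by omega)
          rw [hgf i (by omega)] at this
          rw [show j + (i + 1) = j + 1 + i by ring]
          exact this
      · rcases i with _ | i
        · omega
        · have := hl5 i (by omega) (by omega)
          rwa [hgf i (by omega)] at this
    · -- the tail can be made constant
      push Not at hcase
      set y := f m with hy
      have hy0 : 0 < y := hfpos m le_rfl
      obtain ⟨ht1', ht2⟩ := htrunc y le_rfl hfm0
      have hmin : ∀ i ≤ m, min (f i) y = y := fun i hi =>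
        min_eq_right (hanti' (i + 1) (m + 1) (by omega) le_rfl)
      have hprody : ∏ i ∈ Finset.range m, min (f i) y = y ^ m := by
        rw [Finset.prod_congr rfl fun i hi => hmin i (Finset.mem_range.1 hi).le]
        simp
      rw [hprody] at ht1' ht2
      set z := x 0 + excess y with hz
      have hzy : z = 1 / t - (m + 1) * y := by
        have : excess y = ∑ i ∈ Finset.range (m + 1), f i - (m + 1) * y := by
          simp only [excess]
          rw [Finset.sum_sub_distrib, Finset.sum_congr (g := fun _ => y) rfl
            fun i hi => hmin i (by have := Finset.mem_range.1 hi; omega)]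
          simp
        rw [hz, this]
        linarith
      have hexc0 : 0 ≤ excess y := Finset.sum_nonneg fun i _ => sub_nonneg.2 (min_le_left _ _)
      have hzy' : y ≤ z := by linarith
      have hm0 : (0 : ℝ) < m + 1 := by positivity
      have hyz : y = (1 / t - z) / (m + 1) := by
        rw [hzy]; field_simp; ring
      have hdj : d - j = m + 1 := by omega
      have hdj1 : d - (j + 1) = m := by omega
      -- The left end `z = 1 / ((m + 2) * t)` makes all `m + 2` terms equal and gives
      -- `sylvesterValue d j`; the right end `1 / (t + 1)` gives `sylvesterValue d (j + 1)`.
      have hva : 1 / (M : ℝ) ≤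
          1 / t * (1 / ((m + 2) * t) * ((1 / t - 1 / ((m + 2) * t)) / (m + 1)) ^ m) := by
        have h1 := hM j (by omega)
        have h2 : (sylvesterValue d j : ℝ) = (m + 2) ^ (m + 1) * t ^ (m + 2) := by
          rw [sylvesterValue, hdj]; push_cast; ring
        have h3 : (1 / t - 1 / ((m + 2) * t)) / (m + 1) = 1 / ((m + 2) * t) := by
          field_simp; ring
        have h4 : 1 / t * (1 / ((m + 2) * t) * (1 / ((m + 2) * t)) ^ m) =
            1 / (sylvesterValue d j : ℝ) := by
          rw [h2, div_pow, mul_pow, one_pow]; field_simp; ring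
        rw [h3, h4]
        exact one_div_le_one_div_of_le (Nat.cast_pos.2 (sylvesterValue_pos d j))
          (Nat.cast_le.2 h1)
      have hvb : 1 / (M : ℝ) ≤
          1 / t * (1 / (t + 1) * ((1 / t - 1 / (t + 1)) / (m + 1)) ^ m) := by
        have h1 := hM (j + 1) (by omega)
        have h2 : (sylvesterValue d (j + 1) : ℝ) = (m + 1) ^ m * (t * (t + 1)) ^ (m + 1) := by
          rw [sylvesterValue, hdj1]; push_cast; rw [htsucc]
        have h4 : 1 / t * (1 / (t + 1) * ((1 / t - 1 / (t + 1)) / (m + 1)) ^ m) =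
            1 / (sylvesterValue d (j + 1) : ℝ) := by
          rw [h2, hsx, htsucc, div_pow, div_pow, one_pow]; field_simp; ring
        rw [h4]
        exact one_div_le_one_div_of_le (Nat.cast_pos.2 (sylvesterValue_pos d (j + 1)))
          (Nat.cast_le.2 h1)
      -- `z` is the largest of `m + 2` terms with sum `1 / t`, hence at least their mean.
      have hza : 1 / ((m + 2) * t) ≤ z := by
        have : (m + 2) * z ≥ 1 / t := by nlinarith
        have h5 : 1 / ((m + 2) * t) = (1 / t) / (m + 2) := by field_simp
        rw [h5, div_le_iff₀ (by positivity)]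
        linarith
      have hchain : 1 / t * (z * y ^ m) ≤ 1 / t * (x 0 * ∏ i ∈ Finset.range m, f i) :=
        mul_le_mul_of_nonneg_left ht1' (by positivity)
      rcases hza.eq_or_lt with hza | hza
      · have hyeq : y = 1 / ((m + 2) * t) := by
          rw [hyz, ← hza]; field_simp; ring
        have hlow : 1 / (M : ℝ) ≤ 1 / t * (z * y ^ m) := by
          rw [hyz, ← hza]; exact hva
        refine ⟨hlow.trans hchain, fun heq => ⟨j, le_rfl, by omega, ?_, ?_, ?_⟩⟩
        · have h1 : 1 / (M : ℝ) = 1 / t * (z * y ^ m) := le_antisymm hlow (heq ▸ hchain)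
          have h2 : (sylvesterValue d j : ℝ) = (m + 2) ^ (m + 1) * t ^ (m + 2) := by
            rw [sylvesterValue, hdj]; push_cast; ring
          have h4 : 1 / t * (z * y ^ m) = 1 / (sylvesterValue d j : ℝ) := by
            rw [h2, ← hza, hyeq, div_pow, mul_pow, one_pow]; field_simp; ring
          rw [h4] at h1
          have : (M : ℝ) = sylvesterValue d j := by simpa using h1
          exact_mod_cast this.symm
        · intro i hi; omega
        · have h1 : 1 / (M : ℝ) = 1 / t * (z * y ^ m) := le_antisymm hlow (heq ▸ hchain)
          have h2 : z * y ^ m = x 0 * ∏ i ∈ Finset.range m, f i := by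
            rw [h1] at heq
            exact mul_left_cancel₀ (by positivity) heq
          have hfy : ∀ i ≤ m, f i = y := fun i hi =>
            le_antisymm (ht2 h2 i hi) (hanti' (i + 1) (m + 1) (by omega) le_rfl)
          have hx0z : x 0 = z := by
            have : excess y = 0 := Finset.sum_eq_zero fun i hi => by
              have hi := Finset.mem_range.1 hi
              rw [hmin i (by omega), hfy i (by omega), sub_self]
            rw [hz, this, add_zero]
          intro i _ hi
          have hcast : (((d - j : ℕ) : ℝ) + 1) * t = (m + 2) * t := by
            rw [hdj]; push_cast; ring
          rw [hcast]
          rcases i with _ | i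
          · rw [hx0z, ← hza]
          · exact (hfy i (by omega)).trans hyeq
      -- The right end is excluded by `hcase`, so `z` is an inner point and equality cannot occur.
      · have hstrict : 1 / (M : ℝ) < 1 / t * (z * y ^ m) := by
          have := lt_mul_pow_of_mem_Ioo (s := 1 / t) (a := 1 / ((m + 2) * t)) (b := 1 / (t + 1))
            (z := z) (c := t * (1 / M)) (n := m + 1) m (by positivity) hza hcase
            (one_div_lt_one_div_of_lt ht (by linarith)) hm0
            (by have := mul_le_mul_of_nonneg_left hva ht.le
                rwa [← mul_assoc, mul_one_div_cancel ht.ne', one_mul] at this)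
            (by have := mul_le_mul_of_nonneg_left hvb ht.le
                rwa [← mul_assoc, mul_one_div_cancel ht.ne', one_mul] at this)
          rw [← hyz] at this
          rw [one_div_mul_eq_div, lt_div_iff₀ ht]
          linarith
        refine ⟨(hstrict.trans_le hchain).le, fun heq => ?_⟩
        exact absurd heq (hstrict.trans_le hchain).ne

/-- A partial sum of a unit partition differs from `1` by at least the inverse of the product of
its denominators. -/
theorem prod_inv_le_one_sub_sum_inv (k : ℕ → ℕ) (l : ℕ) (hk : ∀ i < l, 0 < k i)
    (h : ∑ i ∈ Finset.range l, 1 / (k i : ℝ) < 1) :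
    ∏ i ∈ Finset.range l, 1 / (k i : ℝ) ≤ 1 - ∑ i ∈ Finset.range l, 1 / (k i : ℝ) := by
  -- Times the product of the denominators, the difference is an integer; being positive, it is at
  -- least `1`.
  have hint : ∃ a : ℤ, (1 - ∑ i ∈ Finset.range l, 1 / (k i : ℝ)) *
      ∏ i ∈ Finset.range l, (k i : ℝ) = a := by
    clear h
    induction l with
    | zero => exact ⟨1, by simp⟩
    | succ l ih =>
      obtain ⟨a, ha⟩ := ih fun i hi => hk i (by omega)
      refine ⟨a * k l - ∏ i ∈ Finset.range l, (k i : ℤ), ?_⟩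
      have hkl : (k l : ℝ) ≠ 0 := by have := hk l (by omega); positivity
      rw [Finset.sum_range_succ, Finset.prod_range_succ]
      push_cast
      rw [← ha]
      field_simp
      ring
  obtain ⟨a, ha⟩ := hint
  have hp : 0 < ∏ i ∈ Finset.range l, (k i : ℝ) := Finset.prod_pos fun i hi =>
    Nat.cast_pos.2 (hk i (Finset.mem_range.1 hi))
  have ha0 : (0 : ℝ) < a := by rw [← ha]; exact mul_pos (by linarith) hp
  have ha1 : (1 : ℝ) ≤ a := by
    have : 0 < a := by exact_mod_cast ha0
    exact_mod_cast this
  rw [Finset.prod_div_distrib, Finset.prod_const_one, div_le_iff₀ hp, ha]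
  exact ha1

/-- The product of all but the largest of the denominators of a unit partition. -/
theorem prod_castSucc_le_of_sum_inv_eq_one {d M : ℕ} (hM : ∀ l ≤ d, sylvesterValue d l ≤ M)
    (k : Fin (d + 1) → ℕ) (hk : ∀ i, 0 < k i) (hmono : Monotone k)
    (hsum : ∑ i, 1 / (k i : ℝ) = 1) :
    ∏ i : Fin d, k i.castSucc ≤ M ∧ (∏ i : Fin d, k i.castSucc = M →
      ∃ l ≤ d, sylvesterValue d l = M ∧
        ∀ i, k i = if (i : ℕ) < l then sylvesterSeq i else (d - l + 1) * sylvesterT l) := by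
  -- The value `1` outside the range only keeps `K` positive; it enters no sum or product.
  set K : ℕ → ℕ := fun i => if h : i < d + 1 then k ⟨i, h⟩ else 1 with hK
  have hKk : ∀ i : Fin (d + 1), K i = k i := fun i => dif_pos i.2
  have hK0 : ∀ i, 0 < K i := fun i => by
    simp only [hK]; split
    · exact hk _
    · exact one_pos
  have hsumK : ∑ i ∈ Finset.range (d + 1), 1 / (K i : ℝ) = 1 := by
    rw [← Fin.sum_univ_eq_sum_range (fun i => 1 / (K i : ℝ))]
    refine Eq.trans ?_ hsum
    exact Finset.sum_congr rfl fun i _ => by rw [hKk]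
  have hprodK : ∏ i ∈ Finset.range d, K i = ∏ i : Fin d, k i.castSucc := by
    rw [← Fin.prod_univ_eq_prod_range]
    exact Finset.prod_congr rfl fun i _ => by rw [← hKk]; rfl
  have hP : (0 : ℝ) < ∏ i ∈ Finset.range d, (K i : ℝ) :=
    Finset.prod_pos fun i _ => Nat.cast_pos.2 (hK0 i)
  have hM0 : (0 : ℝ) < M := Nat.cast_pos.2 ((sylvesterValue_pos d d).trans_le (hM d le_rfl))
  obtain ⟨h1, h2⟩ := inv_le_prod_of_prefix_le hM d 0 (fun i => 1 / (K i : ℝ)) (by omega)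
    (fun i _ => by have := hK0 i; positivity)
    (fun i hi => by
      refine one_div_le_one_div_of_le (Nat.cast_pos.2 (hK0 i)) (Nat.cast_le.2 ?_)
      have e1 := hKk ⟨i, by omega⟩
      have e2 := hKk ⟨i + 1, by omega⟩
      simp only at e1 e2
      rw [e1, e2]
      exact hmono (Fin.mk_le_mk.2 (by omega)))
    (by rw [hsumK, sylvesterT_zero]; simp)
    (fun l hl => by
      rw [sylvesterT_zero]
      simp only [Nat.cast_one, div_one, one_mul]
      -- A prefix of length `l ≤ d` omits the term of index `d`, so its sum is below `1`.
      refine prod_inv_le_one_sub_sum_inv K l (fun i _ => hK0 i) ?_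
      refine lt_of_lt_of_eq ?_ hsumK
      refine Finset.sum_lt_sum_of_subset (i := d) (Finset.range_subset_range.2 (by omega))
        (Finset.mem_range.2 (by omega)) (by simpa using hl)
        (by have := hK0 d; positivity) (fun i _ _ => by positivity))
  rw [sylvesterT_zero, Finset.prod_div_distrib, Finset.prod_const_one] at h1 h2
  simp only [Nat.cast_one, div_one, one_mul] at h1 h2
  rw [← hprodK]
  refine ⟨?_, fun h => ?_⟩
  · rw [one_div_le_one_div hM0 hP] at h1
    exact_mod_cast h1
  · obtain ⟨l, _, hl, hv, ha, hb⟩ := h2 (by rw [← h]; push_cast; rfl)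
    refine ⟨l, hl, hv, fun i => ?_⟩
    rw [← hKk]
    have hi := i.2
    split
    · have := ha i (by omega)
      simp only [zero_add, one_div, inv_inj] at this
      exact_mod_cast this
    · have := hb i (by omega) (by omega)
      simp only [one_div, inv_inj] at this
      exact_mod_cast this

/-! ### Comparison of the values `sylvesterValue d l` -/

/-- Used with `e = d - l` and `t = t_l`; the three alternatives are `l = 0`, `l = 1` and `l ≥ 2`
when `d ≥ 4`. The inequality fails at `(e, t) = (3, 1)` and `(2, 2)`, the pairs that `d = 3` would
need. -/
theorem three_mul_le_pow (e : ℕ) : ∀ t : ℕ, (4 ≤ e ∧ 1 ≤ t) ∨ (3 ≤ e ∧ 2 ≤ t) ∨ (2 ≤ e ∧ 6 ≤ t) →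
    3 * e * t ≤ (t + 1) ^ e := by
  have step : ∀ e t : ℕ, 1 ≤ e → 1 ≤ t → 3 * e * t ≤ (t + 1) ^ e →
      3 * (e + 1) * t ≤ (t + 1) ^ (e + 1) := by
    intro e t he ht h
    rw [pow_succ]
    nlinarith [Nat.mul_le_mul_left t h, Nat.mul_le_mul he ht,
      Nat.mul_le_mul_right (3 * t) (Nat.mul_le_mul he ht)]
  have from_base : ∀ e₀ t : ℕ, 1 ≤ e₀ → 1 ≤ t → 3 * e₀ * t ≤ (t + 1) ^ e₀ → ∀ e, e₀ ≤ e →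
      3 * e * t ≤ (t + 1) ^ e := by
    intro e₀ t he₀ ht h e he
    induction e, he using Nat.le_induction with
    | base => exact h
    | succ e he ih => exact step e t (by omega) ht ih
  rintro t (⟨he, ht⟩ | ⟨he, ht⟩ | ⟨he, ht⟩)
  · refine from_base 4 t (by omega) ht ?_ e he
    have : (t + 1) ^ 4 = t ^ 4 + 4 * t ^ 3 + 6 * t ^ 2 + 4 * t + 1 := by ring
    nlinarith [Nat.one_le_pow 3 t ht, Nat.one_le_pow 4 t ht, Nat.mul_le_mul ht ht]
  · refine from_base 3 t (by omega) (by omega) ?_ e he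
    have : (t + 1) ^ 3 = t ^ 3 + 3 * t ^ 2 + 3 * t + 1 := by ring
    nlinarith [Nat.mul_le_mul ht ht]
  · refine from_base 2 t (by omega) (by omega) ?_ e he
    nlinarith

/-- This is `(1 + 1 / e) ^ e ≤ exp 1 < 3`. -/
theorem add_one_pow_lt_three_mul (e : ℕ) (he : 0 < e) : (e + 1) ^ e < 3 * e ^ e := by
  have he' : (0 : ℝ) < e := Nat.cast_pos.2 he
  have h1 : (1 + 1 / (e : ℝ)) ^ e < 3 := by
    have h2 : 1 + 1 / (e : ℝ) ≤ Real.exp (1 / e) := by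
      rw [add_comm]; exact Real.add_one_le_exp _
    calc (1 + 1 / (e : ℝ)) ^ e ≤ Real.exp (1 / e) ^ e := by gcongr
      _ = Real.exp 1 := by rw [← Real.exp_nat_mul]; congr 1; field_simp
      _ < 3 := by linarith [Real.exp_one_lt_d9]
  have h3 : ((e : ℝ) + 1) ^ e = (1 + 1 / (e : ℝ)) ^ e * e ^ e := by
    rw [← mul_pow]; congr 1; field_simp
  have h4 : ((e : ℝ) + 1) ^ e < 3 * e ^ e := by
    rw [h3]; gcongr
  exact_mod_cast h4

theorem six_le_sylvesterT {l : ℕ} (hl : 2 ≤ l) : 6 ≤ sylvesterT l := by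
  induction l, hl using Nat.le_induction with
  | base => decide
  | succ l _ ih => rw [sylvesterT_succ]; nlinarith

/-- With `e = d - l` and `t = t_l`, the quotient of the two values is `e ^ (e - 1) * (t + 1) ^ e /
((e + 1) ^ e * t)`. Bounding `(e + 1) ^ e` by `3 * e ^ e` reduces the claim to `three_mul_le_pow`.
-/
theorem sylvesterValue_lt_succ {d l : ℕ} (hd : 4 ≤ d) (hl : l + 2 ≤ d) :
    sylvesterValue d l < sylvesterValue d (l + 1) := by
  obtain ⟨e, rfl⟩ : ∃ e, d = l + (e + 2) := ⟨d - l - 2, by omega⟩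
  set t := sylvesterT l with ht
  have ht1 : 1 ≤ t := sylvesterT_pos l
  rw [sylvesterValue, sylvesterValue, sylvesterT_succ, ← ht,
    show l + (e + 2) - l = e + 2 by omega, show l + (e + 2) - (l + 1) = e + 1 by omega]
  have h1 : 3 * (e + 2) * t ≤ (t + 1) ^ (e + 2) := by
    refine three_mul_le_pow _ _ ?_
    rcases l with _ | _ | l
    · exact Or.inl ⟨by omega, ht1⟩
    · exact Or.inr (Or.inl ⟨by omega, by rw [ht]; decide⟩)
    · exact Or.inr (Or.inr ⟨by omega, six_le_sylvesterT (by omega)⟩)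
  have h2 := add_one_pow_lt_three_mul (e + 2) (by omega)
  have h3 : (e + 2 + 1) ^ (e + 2) * t < (e + 2) ^ (e + 1) * (t + 1) ^ (e + 2) := by
    calc (e + 2 + 1) ^ (e + 2) * t < 3 * (e + 2) ^ (e + 2) * t := by gcongr
      _ = (e + 2) ^ (e + 1) * (3 * (e + 2) * t) := by ring
      _ ≤ _ := by gcongr
  calc (e + 2 + 1) ^ (e + 2) * t ^ (e + 2 + 1)
      = (e + 2 + 1) ^ (e + 2) * t * t ^ (e + 2) := by ring
    _ < (e + 2) ^ (e + 1) * (t + 1) ^ (e + 2) * t ^ (e + 2) := by gcongr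
    _ = (e + 1 + 1) ^ (e + 1) * (t * (t + 1)) ^ (e + 1 + 1) := by rw [mul_pow]; ring

theorem sylvesterValue_sub_one {d : ℕ} (hd : 1 ≤ d) :
    sylvesterValue d (d - 1) = 2 * sylvesterT (d - 1) ^ 2 := by
  rw [sylvesterValue, show d - (d - 1) = 1 by omega]
  ring

/-- The values increase up to `l = d - 1` and then drop: the value at `l = d` is `t_d = t_{d-1}
(t_{d-1} + 1) < 2 t_{d-1}^2`. -/
theorem sylvesterValue_lt {d l : ℕ} (hd : 4 ≤ d) (hl : l ≤ d) (hne : l ≠ d - 1) :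
    sylvesterValue d l < sylvesterValue d (d - 1) := by
  rcases hl.lt_or_eq with hl | rfl
  · have key : ∀ m, l < m → m + 1 ≤ d → sylvesterValue d l < sylvesterValue d m := by
      intro m hm
      induction m, hm using Nat.le_induction with
      | base => exact fun h => sylvesterValue_lt_succ hd (by omega)
      | succ m _ ih => exact fun h => (ih (by omega)).trans (sylvesterValue_lt_succ hd (by omega))
    exact key _ (by omega) (by omega)
  · obtain ⟨m, rfl⟩ : ∃ m, l = m + 1 := ⟨l - 1, by omega⟩
    rw [sylvesterValue_sub_one (by omega), sylvesterValue]
    simp only [Nat.sub_self, Nat.add_sub_cancel, zero_add, pow_one, pow_zero, one_mul]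
    have := six_le_sylvesterT (l := m) (by omega)
    rw [sylvesterT_succ]
    nlinarith

theorem sylvesterValue_le {d l : ℕ} (hd : 4 ≤ d) (hl : l ≤ d) :
    sylvesterValue d l ≤ 2 * sylvesterT (d - 1) ^ 2 := by
  rw [← sylvesterValue_sub_one (by omega)]
  rcases eq_or_ne l (d - 1) with rfl | h
  · exact le_rfl
  · exact (sylvesterValue_lt hd hl h).le

theorem sylvesterValue_two_le {l : ℕ} (hl : l ≤ 2) : sylvesterValue 2 l ≤ 9 := by
  interval_cases l <;> decide

theorem sylvesterValue_three_le {l : ℕ} (hl : l ≤ 3) : sylvesterValue 3 l ≤ 72 := by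
  interval_cases l <;> decide

/-! ### Volumes of simplices -/

/-- Points of the family may repeat: the weights of a convex combination are collected along a
choice of indices. -/
theorem mem_convexHull_range_iff {ι E : Type*} [Fintype ι] [AddCommGroup E] [Module ℝ E]
    (v : ι → E) (x : E) :
    x ∈ convexHull ℝ (Set.range v) ↔
      ∃ c : ι → ℝ, (∀ i, 0 ≤ c i) ∧ ∑ i, c i = 1 ∧ ∑ i, c i • v i = x := by
  classical
  constructor
  · rw [mem_convexHull_iff_exists_fintype]
    rintro ⟨κ, _, w, z, hw, hw1, hz, hx⟩
    choose g hg using hz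
    refine ⟨fun i => ∑ a with g a = i, w a, fun i => Finset.sum_nonneg fun a _ => hw a, ?_, ?_⟩
    · rw [← hw1]
      exact Finset.sum_fiberwise _ g w
    · rw [← hx, ← Finset.sum_fiberwise (g := g)]
      refine Finset.sum_congr rfl fun i _ => ?_
      rw [Finset.sum_smul]
      refine Finset.sum_congr rfl fun a ha => ?_
      rw [← hg a, (Finset.mem_filter.1 ha).2]
  · rintro ⟨c, hc, hc1, hx⟩
    rw [← hx]
    exact (convex_convexHull ℝ _).sum_mem (fun i _ => hc i) hc1
      fun i _ => subset_convexHull ℝ _ (Set.mem_range_self i)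

/-- The simplex cut off from the positive orthant by the hyperplane `∑ x_i = s`. -/
def cornerSimplex (d : ℕ) (s : ℝ) : Set (Fin d → ℝ) :=
  {x | (∀ i, 0 ≤ x i) ∧ ∑ i, x i ≤ s}

theorem cornerSimplex_of_neg {d : ℕ} {s : ℝ} (hs : s < 0) : cornerSimplex d s = ∅ := by
  refine Set.eq_empty_of_forall_notMem fun x hx => ?_
  have := Finset.sum_nonneg fun i (_ : i ∈ Finset.univ) => hx.1 i
  linarith [hx.2]

-- Slicing at first coordinate `a` gives a corner simplex of level `s - a`, and `(s - a) ^ d / d!`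
-- integrates over `[0, s]` to `s ^ (d + 1) / (d + 1)!`.
open MeasureTheory in
theorem volume_cornerSimplex (d : ℕ) {s : ℝ} (hs : 0 ≤ s) :
    volume (cornerSimplex d s) = ENNReal.ofReal (s ^ d / d.factorial) := by
  induction d generalizing s with
  | zero =>
    have : cornerSimplex 0 s = Set.univ := by
      refine Set.eq_univ_of_forall fun x => ⟨fun i => i.elim0, by simpa using hs⟩
    rw [this]
    simp [volume_pi]
  | succ d ih =>
    have hmp := volume_preserving_piFinSuccAbove (fun _ : Fin (d + 1) => ℝ) 0
    set B : Set (ℝ × (Fin d → ℝ)) := {p | 0 ≤ p.1 ∧ p.2 ∈ cornerSimplex d (s - p.1)} with hB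
    have hBm : MeasurableSet B := by
      have h1 : MeasurableSet {p : ℝ × (Fin d → ℝ) | 0 ≤ p.1} :=
        measurableSet_le measurable_const measurable_fst
      have h2 : MeasurableSet {p : ℝ × (Fin d → ℝ) | ∀ i, 0 ≤ p.2 i} := by
        rw [Set.ofPred_forall]
        exact MeasurableSet.iInter fun i => measurableSet_le measurable_const
          ((measurable_pi_apply i).comp measurable_snd)
      have h3 : MeasurableSet {p : ℝ × (Fin d → ℝ) | ∑ i, p.2 i ≤ s - p.1} :=
        measurableSet_le (by fun_prop) (by fun_prop)
      exact h1.inter (h2.inter h3)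
    have hpre : (MeasurableEquiv.piFinSuccAbove (fun _ : Fin (d + 1) => ℝ) 0) ⁻¹' B =
        cornerSimplex (d + 1) s := by
      ext x
      simp only [hB, Set.mem_preimage, Set.mem_ofPred_eq, cornerSimplex,
        MeasurableEquiv.piFinSuccAbove_apply, Fin.insertNthEquiv_symm_apply,
        Fin.removeNth_zero, Fin.forall_fin_succ, Fin.sum_univ_succ, Fin.tail]
      constructor
      · rintro ⟨h1, h2, h3⟩
        exact ⟨⟨h1, h2⟩, by linarith⟩
      · rintro ⟨⟨h1, h2⟩, h3⟩
        exact ⟨h1, h2, by linarith⟩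
    rw [← hpre, hmp.measure_preimage hBm.nullMeasurableSet, Measure.volume_eq_prod,
      Measure.prod_apply hBm]
    have hslice : ∀ a : ℝ, volume (Prod.mk a ⁻¹' B) =
        Set.indicator (Set.Icc 0 s) (fun a => ENNReal.ofReal ((s - a) ^ d / d.factorial)) a := by
      intro a
      by_cases ha : a ∈ Set.Icc 0 s
      · rw [Set.indicator_of_mem ha, ← ih (sub_nonneg.2 ha.2)]
        congr 1
        ext y
        simp [hB, ha.1]
      · rw [Set.indicator_of_notMem ha]
        have : Prod.mk a ⁻¹' B = ∅ := by
          refine Set.eq_empty_of_forall_notMem fun y hy => ha ⟨hy.1, ?_⟩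
          by_contra h
          have := hy.2
          rw [cornerSimplex_of_neg (by simp only; linarith)] at this
          exact this
        rw [this, measure_empty]
    simp_rw [hslice]
    rw [lintegral_indicator measurableSet_Icc, ← ofReal_integral_eq_lintegral_ofReal]
    · congr 1
      rw [integral_Icc_eq_integral_Ioc, ← intervalIntegral.integral_of_le hs,
        intervalIntegral.integral_comp_sub_left (fun x => x ^ d / (d.factorial : ℝ)),
        intervalIntegral.integral_div, integral_pow, Nat.factorial_succ]
      push_cast
      simp
      field_simp
    · exact ContinuousOn.integrableOn_Icc (by fun_prop)
    · refine (ae_restrict_iff' measurableSet_Icc).2 (Filter.Eventually.of_forall fun a ha => ?_)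
      have := sub_nonneg.2 ha.2
      simp only [Pi.zero_apply]
      positivity

/-- The edges from the last vertex of a simplex, as the rows of a matrix. -/
def edgeMatrix {d : ℕ} {R : Type*} [Sub R] (v : Fin (d + 1) → Fin d → R) :
    Matrix (Fin d) (Fin d) R :=
  Matrix.of fun i j => v i.castSucc j - v (Fin.last d) j

-- The hull is the translate by the last vertex of a linear image of `cornerSimplex d 1`, whose
-- volume is `1 / d!`. Degenerate families are covered, with both sides zero.
open MeasureTheory in
theorem normalizedVolume_convexHull {d : ℕ} (v : Fin (d + 1) → Fin d → ℝ) :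
    normalizedVolume (convexHull ℝ (Set.range v)) = |(edgeMatrix v).det| := by
  have himage : convexHull ℝ (Set.range v) =
      (fun y => v (Fin.last d) + y) '' (Matrix.toLin' (edgeMatrix v).transpose ''
        cornerSimplex d 1) := by
    rw [Set.image_image]
    have key : ∀ c : Fin d → ℝ, v (Fin.last d) + Matrix.toLin' (edgeMatrix v).transpose c =
        ∑ i : Fin d, c i • v i.castSucc + (1 - ∑ i, c i) • v (Fin.last d) := by
      intro c
      ext j
      simp only [Matrix.toLin'_apply, Matrix.mulVec, dotProduct, Pi.add_apply, Finset.sum_apply,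
        Pi.smul_apply, smul_eq_mul, Matrix.transpose_apply, edgeMatrix, Matrix.of_apply,
        sub_mul, Finset.sum_sub_distrib, one_mul, Finset.sum_mul, mul_comm (c _)]
      ring
    ext x
    rw [mem_convexHull_range_iff]
    constructor
    · rintro ⟨c, hc, hc1, rfl⟩
      refine ⟨fun i => c i.castSucc, ⟨fun i => hc _, ?_⟩, ?_⟩
      · rw [Fin.sum_univ_castSucc] at hc1
        linarith [hc (Fin.last d)]
      · simp only [key]
        rw [Fin.sum_univ_castSucc] at hc1 ⊢
        rw [← hc1]
        simp
    · rintro ⟨c, ⟨hc, hc1⟩, rfl⟩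
      refine ⟨Fin.snoc c (1 - ∑ i, c i), fun i => ?_, ?_, ?_⟩
      · refine Fin.lastCases ?_ (fun i => ?_) i
        · simpa using hc1
        · simpa using hc i
      · simp [Fin.sum_univ_castSucc]
      · simp only [key]
        simp [Fin.sum_univ_castSucc]
  rw [normalizedVolume, himage, Set.image_add_left, measure_preimage_add,
    Measure.addHaar_image_linearMap, LinearMap.det_toLin', Matrix.det_transpose,
    volume_cornerSimplex d zero_le_one, ENNReal.toReal_mul,
    ENNReal.toReal_ofReal (abs_nonneg _), ENNReal.toReal_ofReal (by positivity)]
  field_simp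
  simp

/-! ### Reflexive simplices and their dual pairs of vertices -/

/-- The inclusion of `ℤ^d` in `ℝ^d`. -/
def castVec {d : ℕ} (z : Fin d → ℤ) : Fin d → ℝ := fun i => z i

theorem castVec_mem_latticePts {d : ℕ} (z : Fin d → ℤ) : castVec z ∈ latticePts d := ⟨z, rfl⟩

theorem castVec_injective {d : ℕ} : Function.Injective (castVec (d := d)) := fun x y h => by
  ext i
  exact Int.cast_injective (congrFun h i)

theorem castVec_dotProduct {d : ℕ} (x y : Fin d → ℤ) :
    castVec x ⬝ᵥ castVec y = ((x ⬝ᵥ y : ℤ) : ℝ) := by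
  simp [castVec, dotProduct]

/-- The lattice points `v_j` and `w_i` are the vertices of a reflexive simplex and of its dual, and
`1 / k_i` are the barycentric coordinates of the origin. -/
structure IsDualPair {d : ℕ} (v w : Fin (d + 1) → Fin d → ℤ) (k : Fin (d + 1) → ℕ) : Prop where
  pos : ∀ i, 0 < k i
  pairing : ∀ i j, w i ⬝ᵥ v j = if i = j then (k i : ℤ) - 1 else -1

namespace IsDualPair

variable {d : ℕ} {v w : Fin (d + 1) → Fin d → ℤ} {k : Fin (d + 1) → ℕ}

theorem symm (h : IsDualPair v w k) : IsDualPair w v k := by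
  refine ⟨h.pos, fun i j => ?_⟩
  rw [dotProduct_comm, h.pairing]
  by_cases hij : i = j
  · subst hij; simp
  · simp [hij, Ne.symm hij]

theorem pairing_cast (h : IsDualPair v w k) (i j : Fin (d + 1)) :
    castVec (w i) ⬝ᵥ castVec (v j) = if i = j then (k i : ℝ) - 1 else -1 := by
  rw [castVec_dotProduct, h.pairing]
  split <;> simp

theorem comp_perm (h : IsDualPair v w k) (σ : Equiv.Perm (Fin (d + 1))) :
    IsDualPair (v ∘ σ) (w ∘ σ) (k ∘ σ) :=
  ⟨fun i => h.pos _, fun i j => by simp [h.pairing]⟩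

/-- Append a coordinate `1` to every `w_i` and `v_i`, and divide the latter by `k_i`. The pairing
relations then say `W * V = 1`; the four claims are the blocks of `V * W = 1`. -/
theorem sum_entries (h : IsDualPair v w k) :
    (∀ a b, ∑ i, (v i a : ℝ) * w i b / k i = if a = b then 1 else 0) ∧
      (∀ a, ∑ i, (v i a : ℝ) / k i = 0) ∧ (∀ b, ∑ i, (w i b : ℝ) / k i = 0) ∧
      ∑ i, 1 / (k i : ℝ) = 1 := by
  let V : Matrix (Fin (d + 1)) (Fin (d + 1)) ℝ :=
    Matrix.of fun a i => Fin.snoc (α := fun _ => ℝ) (fun a => (v i a : ℝ) / k i) (1 / (k i : ℝ)) a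
  let W : Matrix (Fin (d + 1)) (Fin (d + 1)) ℝ :=
    Matrix.of fun i b => Fin.snoc (α := fun _ => ℝ) (fun b => (w i b : ℝ)) 1 b
  have hk : ∀ i, (k i : ℝ) ≠ 0 := fun i => (Nat.cast_pos.2 (h.pos i)).ne'
  have h1 : W * V = 1 := by
    ext i j
    rw [Matrix.mul_apply, Fin.sum_univ_castSucc]
    simp only [W, V, Matrix.of_apply, Fin.snoc_castSucc, Fin.snoc_last, one_mul]
    have h2 : ∑ x : Fin d, (w i x : ℝ) * ((v j x : ℝ) / k j) =
        (castVec (w i) ⬝ᵥ castVec (v j)) / k j := by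
      simp only [castVec, dotProduct, Finset.sum_div, mul_div_assoc]
    rw [h2, h.pairing_cast, Matrix.one_apply, ← add_div]
    by_cases hij : i = j
    · subst hij
      simp [hk]
    · simp [hij]
  have h2 : V * W = 1 := mul_eq_one_comm.1 h1
  have h3 : ∀ a b, (V * W) a b = if a = b then 1 else 0 := fun a b => by
    rw [h2, Matrix.one_apply]
  simp only [Matrix.mul_apply] at h3
  refine ⟨fun a b => ?_, fun a => ?_, fun b => ?_, ?_⟩
  · have := h3 a.castSucc b.castSucc
    simp only [W, V, Matrix.of_apply, Fin.snoc_castSucc, Fin.castSucc_inj] at this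
    rw [← this]
    exact Finset.sum_congr rfl fun i _ => by ring
  · have := h3 a.castSucc (Fin.last d)
    simpa [W, V, Fin.castSucc_ne_last] using this
  · have := h3 (Fin.last d) b.castSucc
    simp only [W, V, Matrix.of_apply, Fin.snoc_castSucc, Fin.snoc_last,
      (Fin.castSucc_ne_last b).symm, if_false] at this
    rw [← this]
    exact Finset.sum_congr rfl fun i _ => by ring
  · have := h3 (Fin.last d) (Fin.last d)
    simpa [W, V] using this

theorem sum_inv (h : IsDualPair v w k) : ∑ i, 1 / (k i : ℝ) = 1 := h.sum_entries.2.2.2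

/-- The barycentric coordinates of a point with respect to the simplex. -/
theorem sum_coord (h : IsDualPair v w k) (x : Fin d → ℝ) :
    ∑ i, (castVec (w i) ⬝ᵥ x + 1) / (k i : ℝ) = 1 := by
  have h1 : ∑ i, (castVec (w i) ⬝ᵥ x) / (k i : ℝ) = 0 := by
    simp only [dotProduct, Finset.sum_div]
    rw [Finset.sum_comm]
    refine Finset.sum_eq_zero fun b _ => ?_
    have := h.sum_entries.2.2.1 b
    calc _ = (∑ i, (w i b : ℝ) / k i) * x b := by
          rw [Finset.sum_mul]
          exact Finset.sum_congr rfl fun i _ => by simp only [castVec]; ring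
      _ = 0 := by rw [this, zero_mul]
  simp only [add_div, Finset.sum_add_distrib, h1, h.sum_inv, zero_add]

theorem sum_coord_smul (h : IsDualPair v w k) (x : Fin d → ℝ) :
    ∑ i, ((castVec (w i) ⬝ᵥ x + 1) / (k i : ℝ)) • castVec (v i) = x := by
  ext a
  simp only [Finset.sum_apply, Pi.smul_apply, smul_eq_mul]
  have h1 : ∀ i, (castVec (w i) ⬝ᵥ x + 1) / (k i : ℝ) * castVec (v i) a =
      ∑ b, (v i a : ℝ) * w i b / k i * x b + (v i a : ℝ) / k i := by
    intro i
    simp only [dotProduct, castVec]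
    rw [add_div, add_mul, Finset.sum_div, Finset.sum_mul]
    congr 1
    · exact Finset.sum_congr rfl fun b _ => by ring
    · ring
  simp only [h1, Finset.sum_add_distrib, h.sum_entries.2.1 a, add_zero]
  rw [Finset.sum_comm]
  simp only [← Finset.sum_mul, h.sum_entries.1 a]
  simp

/-- The simplex spanned by the points `v_j`. -/
theorem mem_convexHull_iff (h : IsDualPair v w k) (x : Fin d → ℝ) :
    x ∈ convexHull ℝ (Set.range fun i => castVec (v i)) ↔
      ∀ i, -1 ≤ castVec (w i) ⬝ᵥ x := by
  rw [mem_convexHull_range_iff]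
  constructor
  · rintro ⟨c, hc, hc1, rfl⟩ i
    have h1 : castVec (w i) ⬝ᵥ ∑ j, c j • castVec (v j) = c i * k i - 1 := by
      rw [dotProduct_sum]
      simp only [dotProduct_smul, smul_eq_mul, h.pairing_cast]
      have : ∀ j, c j * (if i = j then (k i : ℝ) - 1 else -1) =
          (if i = j then c j * k i else 0) - c j := by
        intro j; split <;> ring
      simp only [this, Finset.sum_sub_distrib, hc1, Finset.sum_ite_eq, Finset.mem_univ, if_true]
    rw [h1]
    have := mul_nonneg (hc i) (Nat.cast_nonneg (α := ℝ) (k i))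
    linarith
  · intro hx
    exact ⟨_, fun i => div_nonneg (by linarith [hx i]) (Nat.cast_nonneg _), h.sum_coord x,
      h.sum_coord_smul x⟩

theorem isLatticePolytope_convexHull (v : Fin (d + 1) → Fin d → ℤ) :
    IsLatticePolytope (convexHull ℝ (Set.range fun i => castVec (v i))) := by
  refine ⟨⟨_, Set.finite_range _, rfl⟩, extremePoints_convexHull_subset.trans ?_⟩
  rintro _ ⟨i, rfl⟩
  exact castVec_mem_latticePts _

/-- An inequality `-1 ≤ ⟨y, x⟩` holds for all `y` in the hull once it holds at the vertices, and
these inequalities cut out the hull of the `w_i` by symmetry. -/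
theorem dualPolytope_convexHull (h : IsDualPair v w k) :
    dualPolytope (convexHull ℝ (Set.range fun i => castVec (v i))) =
      convexHull ℝ (Set.range fun i => castVec (w i)) := by
  ext x
  rw [h.symm.mem_convexHull_iff]
  constructor
  · exact fun hx i => hx _ (subset_convexHull ℝ _ ⟨i, rfl⟩)
  · intro hx y hy
    obtain ⟨c, hc, hc1, rfl⟩ := (mem_convexHull_range_iff _ _).1 hy
    rw [sum_dotProduct]
    simp only [smul_dotProduct, smul_eq_mul]
    calc (-1 : ℝ) = ∑ i, c i * (-1) := by rw [← Finset.sum_mul, hc1, one_mul]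
      _ ≤ _ := Finset.sum_le_sum fun i _ => mul_le_mul_of_nonneg_left (hx i) (hc i)

theorem affineIndependent (h : IsDualPair v w k) :
    AffineIndependent ℝ fun i => castVec (v i) := by
  rw [affineIndependent_iff]
  intro s c hc hcv i hi
  have h1 := congrArg (fun x => castVec (w i) ⬝ᵥ x) hcv
  simp only [dotProduct_sum, dotProduct_smul, smul_eq_mul, h.pairing_cast, dotProduct_zero] at h1
  have : ∀ j, c j * (if i = j then (k i : ℝ) - 1 else -1) =
      (if i = j then c j * k i else 0) - c j := by
    intro j; split <;> ring
  simp only [this, Finset.sum_sub_distrib, hc, Finset.sum_ite_eq, hi, if_true, sub_zero] at h1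
  exact (mul_eq_zero.1 h1).resolve_right (Nat.cast_pos.2 (h.pos i)).ne'

theorem isReflexiveSimplex (h : IsDualPair v w k) :
    IsReflexiveSimplex (convexHull ℝ (Set.range fun i => castVec (v i))) := by
  refine ⟨⟨isLatticePolytope_convexHull v, ?_, ?_⟩, _, h.affineIndependent, rfl⟩
  · rw [mem_interior]
    refine ⟨{x | ∀ i, -1 < castVec (w i) ⬝ᵥ x}, fun x hx => ?_, ?_, fun i => by simp⟩
    · exact (h.mem_convexHull_iff x).2 fun i => (hx i).le
    · rw [Set.ofPred_forall]
      exact isOpen_iInter_of_finite fun i => isOpen_lt continuous_const (by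
        unfold dotProduct; fun_prop)
  · rw [h.dualPolytope_convexHull]
    exact isLatticePolytope_convexHull w

end IsDualPair

/-- The vertices of a reflexive simplex and of its dual. -/
theorem IsReflexiveSimplex.exists_isDualPair {d : ℕ} {P : Set (Fin d → ℝ)}
    (hP : IsReflexiveSimplex P) :
    ∃ v w k, IsDualPair (d := d) v w k ∧ P = convexHull ℝ (Set.range fun i => castVec (v i)) := by
  obtain ⟨⟨⟨-, hext⟩, hint, ⟨-, hext'⟩⟩, p, hp, rfl⟩ := hP
  have htop : affineSpan ℝ (Set.range p) = ⊤ :=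
    (hp.affineSpan_eq_top_iff_card_eq_finrank_add_one).2 (by simp)
  let b : AffineBasis (Fin (d + 1)) ℝ (Fin d → ℝ) := ⟨p, hp, htop⟩
  have hbp : ∀ i, b i = p i := fun i => rfl
  have hβ : ∀ i, 0 < b.coord i 0 := by
    have : (0 : Fin d → ℝ) ∈ interior (convexHull ℝ (Set.range b)) := hint
    rw [b.interior_convexHull] at this
    exact this
  have hmem : ∀ x ∈ convexHull ℝ (Set.range p), ∀ i, 0 ≤ b.coord i x := by
    intro x hx
    have : x ∈ convexHull ℝ (Set.range b) := hx
    rw [b.convexHull_eq_nonneg_coord] at this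
    exact this
  have hcoordp : ∀ i j, b.coord i (p j) = if i = j then 1 else 0 := fun i j => by
    rw [← hbp, b.coord_apply]
  have hcomb : ∀ (i : Fin (d + 1)) (x y : Fin d → ℝ) (s t : ℝ), s + t = 1 →
      b.coord i (s • x + t • y) = s * b.coord i x + t * b.coord i y := by
    intro i x y s t hst
    exact Convex.combo_affine_apply hst
  -- the vertices are lattice points
  have hvint : ∀ i, p i ∈ latticePts d := by
    intro i
    refine hext (mem_extremePoints_iff_left.2 ⟨subset_convexHull ℝ _ ⟨i, rfl⟩, ?_⟩)
    rintro x hx y hy ⟨s, t, hs, ht, hst, hxy⟩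
    have h0 : ∀ j, j ≠ i → b.coord j x = 0 := by
      intro j hj
      have h1 := hcomb j x y s t hst
      rw [hxy, hcoordp, if_neg hj] at h1
      have h2 := mul_nonneg hs.le (hmem x hx j)
      have h3 := mul_nonneg ht.le (hmem y hy j)
      have h4 : s * b.coord j x = 0 := by linarith
      exact (mul_eq_zero.1 h4).resolve_left hs.ne'
    have h1 : b.coord i x = 1 := by
      have := b.sum_coord_apply_eq_one x
      rwa [Finset.sum_eq_single i (fun j _ hj => h0 j hj) (by simp)] at this
    refine b.ext_elem fun j => ?_
    rw [hcoordp]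
    split
    · next h => rw [h, h1]
    · next h => exact h0 j h
  -- the vertices of the dual
  let W : Fin (d + 1) → Fin d → ℝ := fun i a =>
    (b.coord i).linear (Pi.single a 1) / b.coord i 0
  -- `W i` is the linear part of `b.coord i`, scaled so that the constant term becomes `1`; it
  -- equals `-1` on the facet opposite to `p i`.
  have hW : ∀ i x, x ⬝ᵥ W i = b.coord i x / b.coord i 0 - 1 := by
    intro i x
    have h1 : b.coord i x = (b.coord i).linear x + b.coord i 0 := by
      have := (b.coord i).map_vadd 0 x
      simpa using this
    have h2 : (b.coord i).linear x = ∑ a, x a * (b.coord i).linear (Pi.single a 1) := by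
      conv_lhs => rw [pi_eq_sum_univ' x]
      simp [map_sum]
    rw [h1, h2, add_div, div_self (hβ i).ne', add_sub_cancel_right, Finset.sum_div]
    simp only [dotProduct, W, mul_div_assoc]
  have hWdual : ∀ i, W i ∈ dualPolytope (convexHull ℝ (Set.range p)) := by
    intro i y hy
    rw [hW]
    have := div_nonneg (hmem y hy i) (hβ i).le
    linarith
  have hbary : ∀ x : Fin d → ℝ, ∑ j, b.coord j x • p j = x := fun x =>
    b.linear_combination_coord_eq_self x
  -- If `W i` is inside a segment of the dual from `y`, then `y` also takes the least value `-1` at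
  -- every `p j`, `j ≠ i`. So `y - W i` is orthogonal to these `p j`, hence to `p i`, because the
  -- origin is a positive combination of the vertices.
  have hWint : ∀ i, W i ∈ latticePts d := by
    intro i
    refine hext' (mem_extremePoints_iff_left.2 ⟨hWdual i, ?_⟩)
    rintro y hy z hz ⟨s, t, hs, ht, hst, hyz⟩
    have h0 : ∀ j, j ≠ i → p j ⬝ᵥ y = -1 := by
      intro j hj
      have h1 : p j ⬝ᵥ W i = -1 := by rw [hW, hcoordp, if_neg (Ne.symm hj)]; simp
      rw [← hyz, dotProduct_add, dotProduct_smul, dotProduct_smul, smul_eq_mul,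
        smul_eq_mul] at h1
      have h2 := hy _ (subset_convexHull ℝ _ ⟨j, rfl⟩)
      have h3 := hz _ (subset_convexHull ℝ _ ⟨j, rfl⟩)
      have h4 := mul_le_mul_of_nonneg_left h3 ht.le
      have h5 : s * (p j ⬝ᵥ y) ≤ s * (-1) := by linarith
      exact le_antisymm (le_of_mul_le_mul_left h5 hs) h2
    have hdiff : ∀ j, p j ⬝ᵥ (y - W i) = 0 := by
      have h1 : ∀ j, j ≠ i → p j ⬝ᵥ (y - W i) = 0 := by
        intro j hj
        rw [dotProduct_sub, h0 j hj, hW, hcoordp, if_neg (Ne.symm hj)]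
        simp
      intro j
      by_cases hj : j = i
      · subst hj
        have h2 := congrArg (fun x => x ⬝ᵥ (y - W j)) (hbary 0)
        simp only [sum_dotProduct, smul_dotProduct, smul_eq_mul, zero_dotProduct] at h2
        rw [Finset.sum_eq_single j (fun l _ hl => by rw [h1 l hl, mul_zero]) (by simp)] at h2
        exact (mul_eq_zero.1 h2).resolve_left (hβ j).ne'
      · exact h1 j hj
    have : y - W i = 0 := by
      refine dotProduct_self_eq_zero.1 ?_
      have h2 := congrArg (fun x => x ⬝ᵥ (y - W i)) (hbary (y - W i))
      simp only [sum_dotProduct, smul_dotProduct, hdiff, smul_zero, Finset.sum_const_zero] at h2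
      exact h2.symm
    exact sub_eq_zero.1 this
  choose v hv using hvint
  choose w hw using hWint
  have hv' : ∀ i, castVec (v i) = p i := hv
  have hw' : ∀ i, castVec (w i) = W i := hw
  have hpair : ∀ i j, ((w i ⬝ᵥ v j : ℤ) : ℝ) =
      if i = j then 1 / b.coord i 0 - 1 else -1 := by
    intro i j
    rw [← castVec_dotProduct, hw', hv', dotProduct_comm, hW, hcoordp]
    split <;> simp
  -- `w i ⬝ᵥ v i + 1` is the inverse of the `i`-th barycentric coordinate of the origin, so it is
  -- positive and `toNat` loses nothing.
  refine ⟨v, w, fun i => (w i ⬝ᵥ v i + 1).toNat, ⟨fun i => ?_, fun i j => ?_⟩, ?_⟩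
  · have h1 := hpair i i
    rw [if_pos rfl] at h1
    have h2 : (0 : ℝ) < ((w i ⬝ᵥ v i + 1 : ℤ) : ℝ) := by
      push_cast
      rw [h1]
      have := one_div_pos.2 (hβ i)
      linarith
    have h3 : 0 < w i ⬝ᵥ v i + 1 := by exact_mod_cast h2
    omega
  · have h1 := hpair i i
    rw [if_pos rfl] at h1
    have h2 : (0 : ℝ) < ((w i ⬝ᵥ v i + 1 : ℤ) : ℝ) := by
      push_cast
      rw [h1]
      have := one_div_pos.2 (hβ i)
      linarith
    have h3 : 0 < w i ⬝ᵥ v i + 1 := by exact_mod_cast h2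
    by_cases hij : i = j
    · subst hij
      rw [if_pos rfl]
      omega
    · have := hpair i j
      rw [if_neg hij] at this ⊢
      exact_mod_cast this
  · congr 1
    ext x
    simp [hv']

/-- Sorting puts the largest `k_i` last, where the volume bound omits it. -/
theorem IsReflexiveSimplex.exists_isDualPair_monotone {d : ℕ} {P : Set (Fin d → ℝ)}
    (hP : IsReflexiveSimplex P) :
    ∃ v w k, IsDualPair (d := d) v w k ∧ Monotone k ∧
      P = convexHull ℝ (Set.range fun i => castVec (v i)) := by
  obtain ⟨v, w, k, h, rfl⟩ := hP.exists_isDualPair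
  refine ⟨_, _, _, h.comp_perm (Tuple.sort k), Tuple.monotone_sort k, ?_⟩
  congr 1
  exact ((Tuple.sort k).surjective.range_comp fun i => castVec (v i)).symm

/-! ### Unimodular equivalence -/

theorem map_mulVec_castVec {d : ℕ} (A : Matrix (Fin d) (Fin d) ℤ) (z : Fin d → ℤ) :
    (A.map (Int.cast : ℤ → ℝ)).mulVec (castVec z) = castVec (A.mulVec z) := by
  ext i
  simp [Matrix.mulVec, dotProduct, castVec]

theorem exists_int_det_of_mapsTo {d : ℕ} (g : (Fin d → ℝ) →ₗ[ℝ] (Fin d → ℝ))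
    (hg : Set.MapsTo g (latticePts d) (latticePts d)) : ∃ n : ℤ, LinearMap.det g = n := by
  have h1 : ∀ j : Fin d, ∃ z : Fin d → ℤ, castVec z = g (Pi.single j 1) := by
    intro j
    refine hg ⟨Pi.single j 1, ?_⟩
    ext i
    by_cases h : i = j
    · subst h; simp
    · simp [h]
  choose z hz using h1
  refine ⟨(Matrix.of fun i j => z j i).det, ?_⟩
  rw [← LinearMap.det_toMatrix', Int.cast_det]
  congr 1
  ext i j
  rw [LinearMap.toMatrix'_apply, ← hz]
  rfl

/-- The map and its inverse preserve the lattice, so their determinants are integers with product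
`1`. -/
theorem UnimodularlyEquivalent.exists_abs_det {d : ℕ} {P P' : Set (Fin d → ℝ)}
    (h : UnimodularlyEquivalent P P') :
    ∃ f : (Fin d → ℝ) ≃ₗ[ℝ] (Fin d → ℝ), f '' latticePts d = latticePts d ∧ f '' P = P' ∧
      |LinearMap.det (f : (Fin d → ℝ) →ₗ[ℝ] (Fin d → ℝ))| = 1 := by
  obtain ⟨f, hf, hP⟩ := h
  refine ⟨f, hf, hP, ?_⟩
  obtain ⟨n, hn⟩ := exists_int_det_of_mapsTo f.toLinearMap
    (fun x hx => hf ▸ Set.mem_image_of_mem f hx)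
  obtain ⟨m, hm⟩ := exists_int_det_of_mapsTo f.symm.toLinearMap (fun x hx => by
    rw [← hf] at hx
    obtain ⟨y, hy, rfl⟩ := hx
    simpa using hy)
  have h1 : LinearMap.det f.toLinearMap * LinearMap.det f.symm.toLinearMap = 1 := by
    rw [← LinearMap.det_comp]
    simp
  rw [hn, hm] at h1
  have h2 : n * m = 1 := by exact_mod_cast h1
  rw [hn]
  rcases Int.eq_one_or_neg_one_of_mul_eq_one h2 with rfl | rfl <;> simp

theorem UnimodularlyEquivalent.normalizedVolume_eq {d : ℕ} {P P' : Set (Fin d → ℝ)}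
    (h : UnimodularlyEquivalent P P') : normalizedVolume P = normalizedVolume P' := by
  obtain ⟨f, -, rfl, hf⟩ := h.exists_abs_det
  rw [normalizedVolume, normalizedVolume]
  have := MeasureTheory.Measure.addHaar_image_linearMap MeasureTheory.volume f.toLinearMap P
  rw [hf, ENNReal.ofReal_one, one_mul] at this
  rw [← this]
  rfl

theorem UnimodularlyEquivalent.numLatticePts_eq {d : ℕ} {P P' : Set (Fin d → ℝ)}
    (h : UnimodularlyEquivalent P P') : numLatticePts P = numLatticePts P' := by
  obtain ⟨f, hf, rfl⟩ := h
  rw [numLatticePts, numLatticePts]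
  nth_rewrite 2 [← hf]
  rw [← Set.image_inter f.injective, Set.ncard_image_of_injective _ f.injective]

/-- The vertices `k_j e_j - u` and `-u`. -/
def diagVertex {d : ℕ} (k : Fin (d + 1) → ℕ) (j : Fin (d + 1)) (i : Fin d) : ℤ :=
  if i.castSucc = j then (k j : ℤ) - 1 else -1

namespace IsDualPair

variable {d : ℕ} {v w : Fin (d + 1) → Fin d → ℤ} {k : Fin (d + 1) → ℕ}

/-- Subtracting the last vertex cancels the `-1` in every pairing. Taking determinants shows that
the volume divides the product of all `k_i` but the last. -/
theorem mul_edgeMatrix_transpose (h : IsDualPair v w k) :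
    (Matrix.of fun i : Fin d => w i.castSucc) * (edgeMatrix v).transpose =
      Matrix.diagonal fun i : Fin d => (k i.castSucc : ℤ) := by
  ext i j
  have h1 : ((Matrix.of fun i : Fin d => w i.castSucc) * (edgeMatrix v).transpose) i j =
      w i.castSucc ⬝ᵥ v j.castSucc - w i.castSucc ⬝ᵥ v (Fin.last d) := by
    simp [Matrix.mul_apply, edgeMatrix, dotProduct, mul_sub, Finset.sum_sub_distrib]
  rw [h1, h.pairing, h.pairing, if_neg (Fin.castSucc_ne_last i), Matrix.diagonal_apply]
  simp only [Fin.castSucc_inj]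
  split <;> simp

theorem det_mul_det (h : IsDualPair v w k) :
    (Matrix.of fun i : Fin d => w i.castSucc).det * (edgeMatrix v).det =
      ∏ i : Fin d, (k i.castSucc : ℤ) := by
  rw [← Matrix.det_transpose (edgeMatrix v), ← Matrix.det_mul, h.mul_edgeMatrix_transpose,
    Matrix.det_diagonal]

theorem normalizedVolume_eq (v : Fin (d + 1) → Fin d → ℤ) :
    normalizedVolume (convexHull ℝ (Set.range fun i => castVec (v i))) =
      ((edgeMatrix v).det.natAbs : ℝ) := by
  rw [normalizedVolume_convexHull, Nat.cast_natAbs, Int.cast_abs, Int.cast_det]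
  congr 2
  ext i j
  simp [edgeMatrix, castVec]

theorem natAbs_det_mul (h : IsDualPair v w k) :
    (Matrix.of fun i : Fin d => w i.castSucc).det.natAbs * (edgeMatrix v).det.natAbs =
      ∏ i : Fin d, k i.castSucc := by
  rw [← Int.natAbs_mul, h.det_mul_det, ← Nat.cast_prod, Int.natAbs_natCast]

theorem natAbs_det_pos (h : IsDualPair v w k) : 0 < (edgeMatrix v).det.natAbs := by
  have h1 : 0 < ∏ i : Fin d, k i.castSucc := Finset.prod_pos fun i _ => h.pos _
  rw [← h.natAbs_det_mul] at h1
  exact Nat.pos_of_mul_pos_left h1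

theorem natAbs_det_le (h : IsDualPair v w k) :
    (edgeMatrix v).det.natAbs ≤ ∏ i : Fin d, k i.castSucc := by
  have h1 : 0 < ∏ i : Fin d, k i.castSucc := Finset.prod_pos fun i _ => h.pos _
  rw [← h.natAbs_det_mul] at h1 ⊢
  exact Nat.le_mul_of_pos_left _ (Nat.pos_of_mul_pos_right h1)

/-- A reflexive simplex of the largest volume for given `k_i` is determined up to equivalence. -/
theorem unimodularlyEquivalent_of_natAbs_det_eq (h : IsDualPair v w k)
    (hvol : (edgeMatrix v).det.natAbs = ∏ i : Fin d, k i.castSucc) :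
    UnimodularlyEquivalent (convexHull ℝ (Set.range fun i => castVec (v i)))
      (convexHull ℝ (Set.range fun i => castVec (diagVertex k i))) := by
  -- Maximal volume leaves `A` determinant `±1`, and `A` sends `v j` to its pairings with the first
  -- `d` covertices, which is `diagVertex k j`.
  set A : Matrix (Fin d) (Fin d) ℤ := Matrix.of fun i : Fin d => w i.castSucc with hA
  have hdet : A.det.natAbs = 1 := by
    have h1 := h.natAbs_det_mul
    rw [← hvol] at h1
    exact Nat.eq_of_mul_eq_mul_right h.natAbs_det_pos (by rw [h1, one_mul])
  have hunit : IsUnit A.det := Int.isUnit_iff_natAbs_eq.2 hdet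
  have hmap : ∀ B C : Matrix (Fin d) (Fin d) ℤ, B * C = 1 →
      B.map (Int.cast : ℤ → ℝ) * C.map (Int.cast : ℤ → ℝ) = 1 := by
    intro B C hBC
    have := congrArg (Int.castRingHom ℝ).mapMatrix hBC
    rw [map_mul, map_one] at this
    exact this
  have h1 := hmap _ _ (Matrix.mul_nonsing_inv A hunit)
  have h2 := hmap _ _ (Matrix.nonsing_inv_mul A hunit)
  let f := Matrix.toLin'OfInv h2 h1
  have hf : ∀ x, f x = (A.map (Int.cast : ℤ → ℝ)).mulVec x := 
    fun x => Matrix.toLin'_apply _ _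
  refine ⟨f, ?_, ?_⟩
  · ext x
    constructor
    · rintro ⟨_, ⟨z, rfl⟩, rfl⟩
      rw [hf]
      exact ⟨_, (map_mulVec_castVec A z).symm⟩
    · rintro ⟨z, rfl⟩
      refine ⟨_, castVec_mem_latticePts (A⁻¹.mulVec z), ?_⟩
      rw [hf, map_mulVec_castVec, Matrix.mulVec_mulVec, Matrix.mul_nonsing_inv A hunit,
        Matrix.one_mulVec]
      rfl
  · have h3 := f.toLinearMap.image_convexHull (Set.range fun i => castVec (v i))
    refine (Eq.trans ?_ h3).trans ?_
    · rfl
    · congr 1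
      rw [← Set.range_comp]
      congr 1
      ext j i
      change f (castVec (v j)) i = _
      rw [hf, map_mulVec_castVec]
      have h4 : A.mulVec (v j) i = w i.castSucc ⬝ᵥ v j := rfl
      rw [castVec, h4, h.pairing, castVec, diagVertex]
      split
      · next h => rw [h]
      · rfl

end IsDualPair

/-! ### The simplices `S_Q` -/

/-- The vertices of the dual of `S_Q`. -/
def diagCovertex {d : ℕ} (Q : Fin (d + 1) → ℕ) : Fin (d + 1) → Fin d → ℤ :=
  Fin.snoc (α := fun _ => Fin d → ℤ) (fun i => Pi.single i 1) fun i => -(Q i.castSucc : ℤ)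

section weightSimplex

variable {d : ℕ} {Q k : Fin (d + 1) → ℕ}

/-- The unit covertices read off coordinates. The last covertex pairs with vertex `j < d` to `k_j
q_j - (|Q| - 1)` up to sign, that is `-1`, and with `-u` to `|Q| - 1 = k_d - 1`, since `q_d = 1`. -/
theorem isDualPair_diagVertex (hk : ∀ i, k i * Q i = ∑ j, Q j) (hpos : ∀ i, 0 < k i)
    (hlast : Q (Fin.last d) = 1) : IsDualPair (diagVertex k) (diagCovertex Q) k := by
  refine ⟨hpos, fun i j => ?_⟩
  refine Fin.lastCases ?_ (fun i => ?_) i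
  · have h1 : diagCovertex Q (Fin.last d) ⬝ᵥ diagVertex k j =
        ∑ i : Fin d, ((Q i.castSucc : ℤ) - if i.castSucc = j then (k j * Q j : ℤ) else 0) := by
      simp only [diagCovertex, diagVertex, Fin.snoc_last, dotProduct]
      refine Finset.sum_congr rfl fun i _ => ?_
      by_cases h : i.castSucc = j
      · subst h; simp; ring
      · simp [h]
    have h2 := hk j
    have h3 := hk (Fin.last d)
    rw [hlast, mul_one] at h3
    rw [h1, Finset.sum_sub_distrib]
    rw [Fin.sum_univ_castSucc, hlast] at h2 h3
    refine Fin.lastCases ?_ (fun j => ?_) j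
    · simp [Fin.castSucc_ne_last, h3]
    · have h4 := hk j.castSucc
      rw [Fin.sum_univ_castSucc, hlast] at h4
      simp only [Fin.castSucc_inj, Finset.sum_ite_eq', Finset.mem_univ, if_true,
        (Fin.castSucc_ne_last j).symm, if_false]
      have h5 : (k j.castSucc * Q j.castSucc : ℤ) = ∑ i : Fin d, (Q i.castSucc : ℤ) + 1 := by
        exact_mod_cast h4
      rw [h5]; ring
  · simp only [diagCovertex, diagVertex, Fin.snoc_castSucc, single_dotProduct, one_mul]
    split
    · next h => rw [h]
    · rfl

theorem weightSimplex_eq (hk : ∀ i, k i * Q i = ∑ j, Q j) (hlast : Q (Fin.last d) = 1) :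
    weightSimplex Q = convexHull ℝ (Set.range fun i => castVec (diagVertex k i)) := by
  have hsum : (∑ j, Q j) ≠ 0 := by
    rw [Fin.sum_univ_castSucc, hlast]
    omega
  have hdiv : ∀ i, ((∑ j, Q j : ℕ) : ℝ) / Q i = k i := by
    intro i
    have : (Q i : ℝ) ≠ 0 := by
      intro h0
      rw [← hk i, Nat.cast_eq_zero.1 h0, mul_zero] at hsum
      exact hsum rfl
    rw [← hk i]
    push_cast
    field_simp
  have hrange : ∀ g : Fin (d + 1) → Fin d → ℝ,
      Set.range g = insert (g (Fin.last d)) (Set.range fun i : Fin d => g i.castSucc) := by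
    intro g
    ext x
    simp only [Set.mem_range, Set.mem_insert_iff]
    constructor
    · rintro ⟨i, rfl⟩
      exact Fin.lastCases (Or.inl rfl) (fun i => Or.inr ⟨i, rfl⟩) i
    · rintro (rfl | ⟨i, rfl⟩)
      · exact ⟨_, rfl⟩
      · exact ⟨_, rfl⟩
  rw [weightSimplex, hrange]
  congr 2
  · ext i
    simp [castVec, diagVertex, Fin.castSucc_ne_last]
  · congr 1
    ext j i
    rw [hdiv]
    by_cases h : i = j
    · subst h; simp [castVec, diagVertex]
    · simp [castVec, diagVertex, h]

theorem isReflexiveSimplex_weightSimplex (hk : ∀ i, k i * Q i = ∑ j, Q j) (hpos : ∀ i, 0 < k i)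
    (hlast : Q (Fin.last d) = 1) : IsReflexiveSimplex (weightSimplex Q) := by
  rw [weightSimplex_eq hk hlast]
  exact (isDualPair_diagVertex hk hpos hlast).isReflexiveSimplex

/-- The first `d` covertices form the identity matrix, so the volume bound is attained. -/
theorem normalizedVolume_weightSimplex (hk : ∀ i, k i * Q i = ∑ j, Q j) (hpos : ∀ i, 0 < k i)
    (hlast : Q (Fin.last d) = 1) :
    normalizedVolume (weightSimplex Q) = ((∏ i : Fin d, k i.castSucc : ℕ) : ℝ) := by
  have h := isDualPair_diagVertex hk hpos hlast
  rw [weightSimplex_eq hk hlast, IsDualPair.normalizedVolume_eq, ← h.natAbs_det_mul]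
  have h1 : (Matrix.of fun i : Fin d => diagCovertex Q i.castSucc) = 1 := by
    ext i j
    simp [diagCovertex, Matrix.one_apply, Pi.single_apply, eq_comm]
  rw [h1]
  simp

end weightSimplex

/-! ### Lattice points of reflexive simplices -/

/-- The sublattice spanned by the edges of a simplex. -/
def edgeLattice {d : ℕ} (v : Fin (d + 1) → Fin d → ℤ) : Submodule ℤ (Fin d → ℤ) :=
  Submodule.span ℤ (Set.range (edgeMatrix v))

theorem card_quotient_edgeLattice {d : ℕ} (v : Fin (d + 1) → Fin d → ℤ)
    (h : (edgeMatrix v).det ≠ 0) :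
    Nat.card ((Fin d → ℤ) ⧸ edgeLattice v) = (edgeMatrix v).det.natAbs := by
  have hli : LinearIndependent ℤ (edgeMatrix v) :=
    Matrix.linearIndependent_rows_of_det_ne_zero h
  rw [← Submodule.natAbs_det_basis_change (Pi.basisFun ℤ (Fin d)) (edgeLattice v)
    (Module.Basis.span hli)]
  congr 1
  rw [Pi.basisFun_det]
  congr 1
  ext i j
  exact congrFun (congrArg Subtype.val (Module.Basis.span_apply hli i)) j

/-- The residues modulo `k_i` of the values of the covertices, as fractional parts. -/
def residue {d : ℕ} (w : Fin (d + 1) → Fin d → ℤ) (k : Fin (d + 1) → ℕ) (z : Fin d → ℤ)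
    (i : Fin (d + 1)) : ℤ := (w i ⬝ᵥ z) % k i

/-- The sum of the fractional parts of a lattice point. -/
noncomputable def height {d : ℕ} (w : Fin (d + 1) → Fin d → ℤ) (k : Fin (d + 1) → ℕ)
    (z : Fin d → ℤ) : ℝ := ∑ i, (residue w k z i : ℝ) / k i

namespace IsDualPair

variable {d : ℕ} {v w : Fin (d + 1) → Fin d → ℤ} {k : Fin (d + 1) → ℕ}

/-- On the generators `v_j - v_d` the pairing is `0` or `±k_i`. Hence residues, and with them the
height, depend only on the class modulo the edge lattice. -/
theorem dvd_of_mem_edgeLattice (h : IsDualPair v w k) {z : Fin d → ℤ} (hz : z ∈ edgeLattice v)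
    (i : Fin (d + 1)) : (k i : ℤ) ∣ w i ⬝ᵥ z := by
  induction hz using Submodule.span_induction with
  | mem x hx =>
    obtain ⟨j, rfl⟩ := hx
    have h1 : w i ⬝ᵥ edgeMatrix v j = w i ⬝ᵥ v j.castSucc - w i ⬝ᵥ v (Fin.last d) := by
      rw [← dotProduct_sub]
      rfl
    rw [h1, h.pairing, h.pairing]
    by_cases h2 : i = j.castSucc
    · simp [h2, Fin.castSucc_ne_last]
    · by_cases h3 : i = Fin.last d
      · rw [if_neg h2, if_pos h3]
        exact ⟨-1, by ring⟩
      · simp [h2, h3]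
  | zero => simp
  | add x y _ _ hx hy => rw [dotProduct_add]; exact dvd_add hx hy
  | smul a x _ hx => rw [dotProduct_smul, smul_eq_mul]; exact hx.mul_left a

theorem residue_eq_of_mk_eq (h : IsDualPair v w k) {x y : Fin d → ℤ}
    (hxy : (Submodule.Quotient.mk x : (Fin d → ℤ) ⧸ edgeLattice v) = Submodule.Quotient.mk y) :
    residue w k x = residue w k y := by
  ext i
  have h1 := h.dvd_of_mem_edgeLattice ((Submodule.Quotient.eq _).1 hxy) i
  rw [dotProduct_sub] at h1
  exact Int.emod_eq_emod_iff_emod_sub_eq_zero.2 (Int.emod_eq_zero_of_dvd h1)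

theorem residue_eq {z : Fin d → ℤ} {i : Fin (d + 1)} {a c : ℤ}
    (hz : w i ⬝ᵥ z = a + k i * c) (h0 : 0 ≤ a) (hk : a < k i) : residue w k z i = a := by
  rw [residue, hz, Int.add_mul_emod_self_left, Int.emod_eq_of_lt h0 hk]

theorem dotProduct_last (h : IsDualPair v w k) (i : Fin (d + 1)) :
    w i ⬝ᵥ v (Fin.last d) = -1 + k i * (if i = Fin.last d then 1 else 0) := by
  rw [h.pairing]
  split <;> ring

/-- The lattice points of a reflexive simplex other than its vertices. -/
def nonVertices (v : Fin (d + 1) → Fin d → ℤ) : Set (Fin d → ℤ) :=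
  {x | castVec x ∈ convexHull ℝ (Set.range fun i => castVec (v i))} \ Set.range v

theorem nonneg_of_mem (h : IsDualPair v w k) {x : Fin d → ℤ}
    (hx : castVec x ∈ convexHull ℝ (Set.range fun i => castVec (v i))) (i : Fin (d + 1)) :
    0 ≤ w i ⬝ᵥ x + 1 := by
  have h1 := (h.mem_convexHull_iff _).1 hx i
  rw [castVec_dotProduct] at h1
  have h2 : (-1 : ℤ) ≤ w i ⬝ᵥ x := by exact_mod_cast h1
  linarith

/-- A barycentric coordinate at least `1` forces the others to vanish, and the point is a vertex. -/
theorem lt_of_mem_nonVertices (h : IsDualPair v w k) {x : Fin d → ℤ} (hx : x ∈ nonVertices v)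
    (i : Fin (d + 1)) : w i ⬝ᵥ x + 1 < k i := by
  by_contra hge
  push Not at hge
  refine hx.2 ⟨i, castVec_injective ?_⟩
  have hk : ∀ j, (0 : ℝ) < k j := fun j => Nat.cast_pos.2 (h.pos j)
  have hsum := h.sum_coord (castVec x)
  have hc : ∀ j, 0 ≤ (castVec (w j) ⬝ᵥ castVec x + 1) / (k j : ℝ) := fun j =>
    div_nonneg (by linarith [(h.mem_convexHull_iff _).1 hx.1 j]) (hk j).le
  have hi : 1 ≤ (castVec (w i) ⬝ᵥ castVec x + 1) / (k i : ℝ) := by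
    rw [one_le_div (hk i), castVec_dotProduct]
    exact_mod_cast hge
  rw [← Finset.add_sum_erase _ _ (Finset.mem_univ i)] at hsum
  have h0 := Finset.sum_nonneg fun j (_ : j ∈ Finset.univ.erase i) => hc j
  have h1 : ∑ j ∈ Finset.univ.erase i, (castVec (w j) ⬝ᵥ castVec x + 1) / (k j : ℝ) = 0 := by
    linarith
  have h2 := (Finset.sum_eq_zero_iff_of_nonneg fun j _ => hc j).1 h1
  have h3 := h.sum_coord_smul (castVec x)
  rw [← Finset.add_sum_erase _ _ (Finset.mem_univ i),
    Finset.sum_eq_zero fun j hj => by rw [h2 j hj, zero_smul], add_zero,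
    show (castVec (w i) ⬝ᵥ castVec x + 1) / (k i : ℝ) = 1 by linarith, one_smul] at h3
  exact h3

/-- Modulo `k_i`, subtracting the last vertex adds `1`. The result already lies in `[0, k_i)`, so
the residues are the numerators of the barycentric coordinates. -/
theorem residue_sub (h : IsDualPair v w k) {x : Fin d → ℤ} (hx : x ∈ nonVertices v)
    (i : Fin (d + 1)) : residue w k (x - v (Fin.last d)) i = w i ⬝ᵥ x + 1 := by
  refine residue_eq (c := -(if i = Fin.last d then 1 else 0)) ?_ (h.nonneg_of_mem hx.1 i)
    (h.lt_of_mem_nonVertices hx i)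
  rw [dotProduct_sub, h.dotProduct_last]
  ring

/-- The reflection `y ↦ v_d - y` replaces a residue `a` by `k_i - 1 - a`, and so exchanges heights
`1` and `d - 1`. -/
theorem residue_sub_sub (h : IsDualPair v w k) {x : Fin d → ℤ} (hx : x ∈ nonVertices v)
    (i : Fin (d + 1)) :
    residue w k (v (Fin.last d) - (x - v (Fin.last d))) i = k i - 1 - (w i ⬝ᵥ x + 1) := by
  have h1 := h.nonneg_of_mem hx.1 i
  have h2 := h.lt_of_mem_nonVertices hx i
  refine residue_eq (c := 2 * (if i = Fin.last d then 1 else 0) - 1) ?_ (by linarith)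
    (by linarith)
  rw [dotProduct_sub, dotProduct_sub, h.dotProduct_last]
  ring

theorem residue_last (h : IsDualPair v w k) (i : Fin (d + 1)) :
    residue w k (v (Fin.last d)) i = k i - 1 := by
  have := h.pos i
  refine residue_eq (c := (if i = Fin.last d then 1 else 0) - 1) ?_ (by omega) (by omega)
  rw [h.dotProduct_last]
  ring

theorem height_zero : height w k 0 = 0 := by
  simp [height, residue]

theorem height_sub (h : IsDualPair v w k) {x : Fin d → ℤ} (hx : x ∈ nonVertices v) :
    height w k (x - v (Fin.last d)) = 1 := by
  rw [height, ← h.sum_coord (castVec x)]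
  refine Finset.sum_congr rfl fun i _ => ?_
  rw [h.residue_sub hx, castVec_dotProduct]
  push_cast
  rfl

theorem sum_one_sub (h : IsDualPair v w k) : ∑ i, ((k i : ℝ) - 1) / k i = d := by
  have : ∀ i, ((k i : ℝ) - 1) / k i = 1 - 1 / k i := fun i => by
    have : (k i : ℝ) ≠ 0 := (Nat.cast_pos.2 (h.pos i)).ne'
    field_simp
  simp only [this, Finset.sum_sub_distrib, h.sum_inv]
  simp

theorem height_last (h : IsDualPair v w k) : height w k (v (Fin.last d)) = d := by
  rw [height, ← h.sum_one_sub]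
  refine Finset.sum_congr rfl fun i _ => ?_
  rw [h.residue_last]
  push_cast
  rfl

theorem height_sub_sub (h : IsDualPair v w k) {x : Fin d → ℤ} (hx : x ∈ nonVertices v) :
    height w k (v (Fin.last d) - (x - v (Fin.last d))) = d - 1 := by
  have h1 : ∑ i, ((k i : ℝ) - 1) / k i - ∑ i, (castVec (w i) ⬝ᵥ castVec x + 1) / (k i : ℝ) =
      d - 1 := by
    rw [h.sum_one_sub, h.sum_coord]
  rw [height, ← h1, ← Finset.sum_sub_distrib]
  refine Finset.sum_congr rfl fun i _ => ?_
  rw [h.residue_sub_sub hx, castVec_dotProduct, ← sub_div]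
  push_cast
  rfl

theorem eq_of_dotProduct_eq (h : IsDualPair v w k) {x y : Fin d → ℤ}
    (hxy : ∀ i, w i ⬝ᵥ x = w i ⬝ᵥ y) : x = y := by
  refine castVec_injective ?_
  rw [← h.sum_coord_smul (castVec x), ← h.sum_coord_smul (castVec y)]
  refine Finset.sum_congr rfl fun i _ => ?_
  rw [castVec_dotProduct, castVec_dotProduct, hxy]

theorem mk_sub_injective (h : IsDualPair v w k) : Function.Injective fun x : nonVertices v =>
    (Submodule.Quotient.mk (x.1 - v (Fin.last d)) : (Fin d → ℤ) ⧸ edgeLattice v) := by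
  intro x y hxy
  have h1 := h.residue_eq_of_mk_eq hxy
  refine Subtype.ext (h.eq_of_dotProduct_eq fun i => ?_)
  have h2 := congrFun h1 i
  rw [h.residue_sub x.2, h.residue_sub y.2] at h2
  linarith

theorem mk_sub_sub_injective (h : IsDualPair v w k) : Function.Injective fun x : nonVertices v =>
    (Submodule.Quotient.mk (v (Fin.last d) - (x.1 - v (Fin.last d))) :
      (Fin d → ℤ) ⧸ edgeLattice v) := by
  intro x y hxy
  have h1 := h.residue_eq_of_mk_eq hxy
  refine Subtype.ext (h.eq_of_dotProduct_eq fun i => ?_)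
  have h2 := congrFun h1 i
  rw [h.residue_sub_sub x.2, h.residue_sub_sub y.2] at h2
  linarith

theorem mk_ne_of_height_ne (h : IsDualPair v w k) {x y : Fin d → ℤ}
    (hxy : height w k x ≠ height w k y) :
    (Submodule.Quotient.mk x : (Fin d → ℤ) ⧸ edgeLattice v) ≠ Submodule.Quotient.mk y := by
  intro he
  refine hxy ?_
  rw [height, height, h.residue_eq_of_mk_eq he]

theorem card_quotient (h : IsDualPair v w k) :
    Nat.card ((Fin d → ℤ) ⧸ edgeLattice v) = (edgeMatrix v).det.natAbs :=
  card_quotient_edgeLattice v (Int.natAbs_pos.1 h.natAbs_det_pos)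

theorem finite_quotient (h : IsDualPair v w k) : Finite ((Fin d → ℤ) ⧸ edgeLattice v) :=
  Nat.finite_of_card_ne_zero (by rw [h.card_quotient]; exact h.natAbs_det_pos.ne')

theorem finite_nonVertices (h : IsDualPair v w k) : Finite (nonVertices v) :=
  have := h.finite_quotient
  Finite.of_injective _ h.mk_sub_injective

theorem numLatticePts_le (v : Fin (d + 1) → Fin d → ℤ) :
    numLatticePts (convexHull ℝ (Set.range fun i => castVec (v i))) ≤
      Nat.card (nonVertices v) + (d + 1) := by
  have h1 : convexHull ℝ (Set.range fun i => castVec (v i)) ∩ latticePts d =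
      castVec '' {x | castVec x ∈ convexHull ℝ (Set.range fun i => castVec (v i))} := by
    ext x
    constructor
    · rintro ⟨hx, z, rfl⟩
      exact ⟨z, hx, rfl⟩
    · rintro ⟨z, hz, rfl⟩
      exact ⟨hz, castVec_mem_latticePts z⟩
  rw [numLatticePts, h1, Set.ncard_image_of_injective _ castVec_injective]
  refine (Set.ncard_le_ncard_sdiff_add_ncard _ (Set.range v) (Set.finite_range v)).trans ?_
  refine Nat.add_le_add (le_of_eq rfl) ?_
  rw [← Set.image_univ]
  refine (Set.ncard_image_le Set.finite_univ).trans ?_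
  simp [Set.ncard_univ]

/-- The lattice points of a reflexive triangle and its area. -/
theorem numLatticePts_le_two {v w : Fin 3 → Fin 2 → ℤ} {k : Fin 3 → ℕ} (h : IsDualPair v w k) :
    numLatticePts (convexHull ℝ (Set.range fun i => castVec (v i))) ≤
      (edgeMatrix v).det.natAbs + 1 := by
  have := h.finite_quotient
  have := h.finite_nonVertices
  have hz := height_zero (w := w) (k := k)
  have hl : height w k (v 2) = 2 := by simpa using h.height_last
  -- The classes have heights `1` for the non-vertices and `0`, `2` for the two extra elements, so
  -- they are distinct.
  have hinj : Function.Injective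
      (Sum.elim (fun x : nonVertices v => (Submodule.Quotient.mk (x.1 - v (Fin.last 2)) :
        (Fin 2 → ℤ) ⧸ edgeLattice v))
        fun b : Bool => Submodule.Quotient.mk (if b then v (Fin.last 2) else 0)) := by
    refine h.mk_sub_injective.sumElim ?_ ?_
    · rw [Bool.injective_iff]
      refine h.mk_ne_of_height_ne ?_
      simp [hz, hl]
    · intro x b
      refine h.mk_ne_of_height_ne ?_
      rw [h.height_sub x.2]
      cases b <;> simp [hz, hl]
  have h1 := Nat.card_le_card_of_injective _ hinj
  rw [Nat.card_sum, h.card_quotient] at h1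
  have h2 : numLatticePts (convexHull ℝ (Set.range fun i => castVec (v i))) ≤
      Nat.card (nonVertices v) + (2 + 1) := numLatticePts_le v
  simp only [Nat.card_eq_fintype_card (α := Bool), Fintype.card_bool] at h1
  omega

/-- The lattice points of a three-dimensional reflexive simplex and its volume. -/
theorem numLatticePts_le_three {v w : Fin 4 → Fin 3 → ℤ} {k : Fin 4 → ℕ}
    (h : IsDualPair v w k) :
    2 * numLatticePts (convexHull ℝ (Set.range fun i => castVec (v i))) ≤
      (edgeMatrix v).det.natAbs + 6 := by
  have := h.finite_quotient
  have := h.finite_nonVertices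
  have hz := height_zero (w := w) (k := k)
  have hl : height w k (v 3) = 3 := by simpa using h.height_last
  -- Four kinds of classes, separated by their heights `1`, `2`, `0` and `3`.
  have hinj : Function.Injective
      (Sum.elim (Sum.elim (fun x : nonVertices v => (Submodule.Quotient.mk (x.1 - v (Fin.last 3)) :
        (Fin 3 → ℤ) ⧸ edgeLattice v))
        fun x : nonVertices v => Submodule.Quotient.mk (v (Fin.last 3) - (x.1 - v (Fin.last 3))))
        fun b : Bool => Submodule.Quotient.mk (if b then v (Fin.last 3) else 0)) := by
    refine (h.mk_sub_injective.sumElim h.mk_sub_sub_injective ?_).sumElim ?_ ?_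
    · intro x y
      refine h.mk_ne_of_height_ne ?_
      rw [h.height_sub x.2, h.height_sub_sub y.2]
      norm_num
    · rw [Bool.injective_iff]
      refine h.mk_ne_of_height_ne ?_
      simp [hz, hl]
    · rintro (x | x) b
      · refine h.mk_ne_of_height_ne ?_
        rw [h.height_sub x.2]
        cases b <;> simp [hz, hl]
      · refine h.mk_ne_of_height_ne ?_
        rw [h.height_sub_sub x.2]
        (cases b <;> simp [hz, hl]); norm_num
  have h1 := Nat.card_le_card_of_injective _ hinj
  rw [Nat.card_sum, Nat.card_sum, h.card_quotient] at h1
  have h2 : numLatticePts (convexHull ℝ (Set.range fun i => castVec (v i))) ≤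
      Nat.card (nonVertices v) + (3 + 1) := numLatticePts_le v
  simp only [Nat.card_eq_fintype_card (α := Bool), Fintype.card_bool] at h1
  omega

end IsDualPair

/-! ### The extremal simplices -/

/-- The unit partition with `l` Sylvester denominators and constant remaining denominators. -/
def sylvesterPartition (d l : ℕ) (i : Fin (d + 1)) : ℕ :=
  if (i : ℕ) < l then sylvesterSeq i else (d - l + 1) * sylvesterT l

theorem sylvesterPartition_pos (d l : ℕ) (i : Fin (d + 1)) : 0 < sylvesterPartition d l i := by
  unfold sylvesterPartition
  have := sylvesterSeq_pos i
  have := sylvesterT_pos l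
  split
  · omega
  · positivity

/-- This is `1 / y_0 + ⋯ + 1 / y_{n-1} + 1 / t_n = 1` times `t_n`; the induction multiplies by
`y_n`, as `t_{n+1} = y_n t_n`. -/
theorem sum_sylvesterT_div (n : ℕ) :
    ∑ i ∈ Finset.range n, sylvesterT n / sylvesterSeq i + 1 = sylvesterT n := by
  induction n with
  | zero => rfl
  | succ n ih =>
    have h1 : sylvesterT (n + 1) = sylvesterSeq n * sylvesterT n := by
      rw [sylvesterT_succ, sylvesterSeq_eq_sylvesterT_add_one]; ring
    have h2 : ∀ i ∈ Finset.range n, sylvesterT (n + 1) / sylvesterSeq i =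
        sylvesterSeq n * (sylvesterT n / sylvesterSeq i) := fun i hi => by
      rw [h1, Nat.mul_div_assoc _ (sylvesterSeq_dvd_sylvesterT (Finset.mem_range.1 hi))]
    rw [Finset.sum_range_succ, Finset.sum_congr rfl h2, ← Finset.mul_sum, h1,
      Nat.mul_div_cancel_left _ (by have := sylvesterSeq_pos n; omega)]
    nth_rewrite 3 [← ih]
    rw [sylvesterSeq_eq_sylvesterT_add_one]
    ring

theorem sum_enlargedSylvester {d : ℕ} (hd : 1 ≤ d) :
    ∑ i, enlargedSylvester d i = 2 * sylvesterT (d - 1) := by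
  obtain ⟨n, rfl⟩ : ∃ n, d = n + 1 := ⟨d - 1, by omega⟩
  rw [Fin.sum_univ_castSucc, Fin.sum_univ_castSucc]
  simp only [enlargedSylvester, Fin.val_castSucc, Fin.val_last, Nat.add_sub_cancel, Fin.is_lt,
    if_true, lt_irrefl, if_false, show ¬ n + 1 < n by omega]
  rw [Fin.sum_univ_eq_sum_range (fun i => 2 * sylvesterT n / sylvesterSeq i)]
  nth_rewrite 2 [← sum_sylvesterT_div n]
  rw [mul_add, Finset.mul_sum, add_assoc]
  congr 1
  exact Finset.sum_congr rfl fun i hi =>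
    Nat.mul_div_assoc _ (sylvesterSeq_dvd_sylvesterT (Finset.mem_range.1 hi))

/-- Identifies `S_{Q'_d}` as the extremal simplex of level `l = d - 1`; the last two denominators
are `2 t_{d-1}`. -/
theorem sylvesterPartition_mul_enlargedSylvester {d : ℕ} (hd : 1 ≤ d) (i : Fin (d + 1)) :
    sylvesterPartition d (d - 1) i * enlargedSylvester d i = ∑ j, enlargedSylvester d j := by
  rw [sum_enlargedSylvester hd, sylvesterPartition, enlargedSylvester]
  split
  · next h => exact Nat.mul_div_cancel' ((sylvesterSeq_dvd_sylvesterT h).mul_left 2)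
  · rw [show d - (d - 1) + 1 = 2 by omega, mul_one]

theorem enlargedSylvester_last (d : ℕ) : enlargedSylvester d (Fin.last d) = 1 := by
  simp [enlargedSylvester]

theorem prod_sylvesterPartition {d l : ℕ} (hl : l ≤ d) :
    ∏ i : Fin d, sylvesterPartition d l i.castSucc = sylvesterValue d l := by
  simp only [sylvesterPartition, Fin.val_castSucc]
  rw [Fin.prod_univ_eq_prod_range
    (fun i => if i < l then sylvesterSeq i else (d - l + 1) * sylvesterT l),
    ← Finset.prod_range_mul_prod_Ico _ hl]
  have h1 : ∏ i ∈ Finset.range l, (if i < l then sylvesterSeq i else (d - l + 1) * sylvesterT l) =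
      sylvesterT l := by
    rw [Finset.prod_congr rfl fun i hi => if_pos (Finset.mem_range.1 hi), sylvesterT,
      sylvesterSeq_eq_one_add_prod l, Nat.add_sub_cancel_left]
  rw [h1, Finset.prod_congr rfl fun i hi => if_neg (by have := Finset.mem_Ico.1 hi; omega)]
  rw [Finset.prod_const, Nat.card_Ico, sylvesterValue, mul_pow]
  ring

/-- The volume of a reflexive simplex, with equality only for diagonal simplices. -/
theorem IsReflexiveSimplex.exists_volume {d M : ℕ} (hM : ∀ l ≤ d, sylvesterValue d l ≤ M)
    {P : Set (Fin d → ℝ)} (hP : IsReflexiveSimplex P) :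
    ∃ v w k, IsDualPair (d := d) v w k ∧ P = convexHull ℝ (Set.range fun i => castVec (v i)) ∧
      normalizedVolume P = ((edgeMatrix v).det.natAbs : ℝ) ∧ (edgeMatrix v).det.natAbs ≤ M ∧
      ((edgeMatrix v).det.natAbs = M → ∃ l ≤ d, sylvesterValue d l = M ∧
        UnimodularlyEquivalent P (convexHull ℝ (Set.range fun i =>
          castVec (diagVertex (sylvesterPartition d l) i)))) := by
  obtain ⟨v, w, k, h, hmono, rfl⟩ := hP.exists_isDualPair_monotone
  obtain ⟨h1, h2⟩ := prod_castSucc_le_of_sum_inv_eq_one hM k h.pos hmono h.sum_inv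
  refine ⟨v, w, k, h, rfl, IsDualPair.normalizedVolume_eq v, h.natAbs_det_le.trans h1,
    fun he => ?_⟩
  -- In `Vol ≤ ∏ k_i ≤ M` both inequalities become equalities: the second determines `k`, the first
  -- then determines the simplex.
  have h3 : ∏ i : Fin d, k i.castSucc = M := le_antisymm h1 (he ▸ h.natAbs_det_le)
  obtain ⟨l, hl, hv, hk⟩ := h2 h3
  obtain rfl : k = sylvesterPartition d l := funext hk
  exact ⟨l, hl, hv, h.unimodularlyEquivalent_of_natAbs_det_eq (he.trans h3.symm)⟩

theorem IsDualPair.card_le_numLatticePts {d : ℕ} {v w : Fin (d + 1) → Fin d → ℤ}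
    {k : Fin (d + 1) → ℕ} (h : IsDualPair v w k) (S : Finset (Fin d → ℤ))
    (hS : ∀ z ∈ S, ∀ i, -1 ≤ w i ⬝ᵥ z) :
    S.card ≤ numLatticePts (convexHull ℝ (Set.range fun i => castVec (v i))) := by
  -- Finiteness is needed because `ncard` of an infinite set is `0`.
  have hfin : (convexHull ℝ (Set.range fun i => castVec (v i)) ∩ latticePts d).Finite := by
    have h1 : (nonVertices v ∪ Set.range v).Finite :=
      (Set.finite_coe_iff.1 h.finite_nonVertices).union (Set.finite_range v)
    refine (h1.image castVec).subset ?_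
    rintro x ⟨hx, z, rfl⟩
    refine ⟨z, ?_, rfl⟩
    by_cases hz : z ∈ Set.range v
    · exact Or.inr hz
    · exact Or.inl ⟨hx, hz⟩
  rw [numLatticePts, ← Set.ncard_coe_finset, ← Set.ncard_image_of_injective _ castVec_injective]
  refine Set.ncard_le_ncard ?_ hfin
  rintro _ ⟨z, hz, rfl⟩
  refine ⟨(h.mem_convexHull_iff _).2 fun i => ?_, castVec_mem_latticePts z⟩
  rw [castVec_dotProduct]
  exact_mod_cast hS z hz i

/-- Translation by `u` turns the lattice points of `S_Q` into the `p ≥ 0` with `q_0 p_0 + q_1 p_1 ≤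
|Q|`. -/
theorem numLatticePts_weightSimplex_two {Q k : Fin 3 → ℕ} (hk : ∀ i, k i * Q i = ∑ j, Q j)
    (hpos : ∀ i, 0 < k i) (hlast : Q (Fin.last 2) = 1) (T : Finset (ℕ × ℕ))
    (hT : ∀ p ∈ T, Q 0 * p.1 + Q 1 * p.2 ≤ ∑ j, Q j) :
    T.card ≤ numLatticePts (weightSimplex (d := 2) Q) := by
  rw [weightSimplex_eq (d := 2) hk hlast]
  have hinj : Function.Injective fun p : ℕ × ℕ => (![(p.1 : ℤ) - 1, (p.2 : ℤ) - 1] : Fin 2 → ℤ) := by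
    intro p q hpq
    have h0 := congrFun hpq 0
    have h1 := congrFun hpq 1
    simp at h0 h1
    exact Prod.ext h0 h1
  rw [← Finset.card_image_of_injective T hinj]
  refine (isDualPair_diagVertex (d := 2) hk hpos hlast).card_le_numLatticePts _ fun z hz i => ?_
  obtain ⟨p, hp, rfl⟩ := Finset.mem_image.1 hz
  have h1 := hT p hp
  have h2 : Q 2 = 1 := hlast
  rw [Fin.sum_univ_three, h2] at h1
  refine Fin.lastCases ?_ (fun i => ?_) i
  · simp only [diagCovertex, Fin.snoc_last, dotProduct]
    simp [Fin.sum_univ_two]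
    zify at h1
    linarith
  · simp only [diagCovertex, Fin.snoc_castSucc, single_dotProduct, one_mul]
    fin_cases i <;> simp <;> omega

theorem numLatticePts_weightSimplex_three {Q k : Fin 4 → ℕ} (hk : ∀ i, k i * Q i = ∑ j, Q j)
    (hpos : ∀ i, 0 < k i) (hlast : Q (Fin.last 3) = 1) (T : Finset (ℕ × ℕ × ℕ))
    (hT : ∀ p ∈ T, Q 0 * p.1 + Q 1 * p.2.1 + Q 2 * p.2.2 ≤ ∑ j, Q j) :
    T.card ≤ numLatticePts (weightSimplex (d := 3) Q) := by
  rw [weightSimplex_eq (d := 3) hk hlast]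
  have hinj : Function.Injective fun p : ℕ × ℕ × ℕ =>
      (![(p.1 : ℤ) - 1, (p.2.1 : ℤ) - 1, (p.2.2 : ℤ) - 1] : Fin 3 → ℤ) := by
    intro p q hpq
    have h0 := congrFun hpq 0
    have h1 := congrFun hpq 1
    have h2 := congrFun hpq 2
    simp at h0 h1 h2
    exact Prod.ext h0 (Prod.ext h1 h2)
  rw [← Finset.card_image_of_injective T hinj]
  refine (isDualPair_diagVertex (d := 3) hk hpos hlast).card_le_numLatticePts _ fun z hz i => ?_
  obtain ⟨p, hp, rfl⟩ := Finset.mem_image.1 hz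
  have h1 := hT p hp
  have h2 : Q 3 = 1 := hlast
  rw [Fin.sum_univ_four, h2] at h1
  refine Fin.lastCases ?_ (fun i => ?_) i
  · simp only [diagCovertex, Fin.snoc_last, dotProduct]
    simp [Fin.sum_univ_three]
    zify at h1
    linarith
  · simp only [diagCovertex, Fin.snoc_castSucc, single_dotProduct, one_mul]
    fin_cases i <;> simp <;> omega

/-- The volume and the number of lattice points of a reflexive triangle. -/
theorem IsReflexiveSimplex.bounds_two {P : Set (Fin 2 → ℝ)} (hP : IsReflexiveSimplex P) :
    ∃ D : ℕ, normalizedVolume P = D ∧ D ≤ 9 ∧ numLatticePts P ≤ D + 1 ∧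
      (D = 9 → UnimodularlyEquivalent P (convexHull ℝ (Set.range fun i =>
          castVec (diagVertex (sylvesterPartition 2 0) i)))) := by
  obtain ⟨v, w, k, h, hPv, hvol, hle, heq⟩ :=
    hP.exists_volume (M := 9) fun l hl => sylvesterValue_two_le hl
  refine ⟨_, hvol, hle, hPv ▸ h.numLatticePts_le_two, fun hD => ?_⟩
  obtain ⟨l, hl, hv, he⟩ := heq hD
  -- The values for `l = 0, 1, 2` are `9, 8, 6`.
  interval_cases l
  · exact he
  · exact absurd hv (by decide)
  · exact absurd hv (by decide)

/-- The volume and the number of lattice points of a three-dimensional reflexive simplex. -/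
theorem IsReflexiveSimplex.bounds_three {P : Set (Fin 3 → ℝ)} (hP : IsReflexiveSimplex P) :
    ∃ D : ℕ, normalizedVolume P = D ∧ D ≤ 72 ∧ 2 * numLatticePts P ≤ D + 6 ∧
      (D = 72 → UnimodularlyEquivalent P (convexHull ℝ (Set.range fun i =>
          castVec (diagVertex (sylvesterPartition 3 1) i))) ∨
        UnimodularlyEquivalent P (convexHull ℝ (Set.range fun i =>
          castVec (diagVertex (sylvesterPartition 3 2) i)))) := by
  obtain ⟨v, w, k, h, hPv, hvol, hle, heq⟩ :=
    hP.exists_volume (M := 72) fun l hl => sylvesterValue_three_le hl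
  refine ⟨_, hvol, hle, hPv ▸ h.numLatticePts_le_three, fun hD => ?_⟩
  obtain ⟨l, hl, hv, he⟩ := heq hD
  -- The values for `l = 0, 1, 2, 3` are `64, 72, 72, 42`.
  interval_cases l
  · exact absurd hv (by decide)
  · exact Or.inl he
  · exact Or.inr he
  · exact absurd hv (by decide)

theorem sylvesterPartition_two_mul (i : Fin 3) :
    sylvesterPartition 2 0 i * ![1, 1, 1] i = ∑ j, ![1, 1, 1] j := by
  fin_cases i <;> decide

theorem sylvesterPartition_three_mul (i : Fin 4) :
    sylvesterPartition 3 1 i * ![3, 1, 1, 1] i = ∑ j, ![3, 1, 1, 1] j := by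
  fin_cases i <;> decide

theorem ten_le_numLatticePts : 10 ≤ numLatticePts (weightSimplex (d := 2) ![1, 1, 1]) :=
  numLatticePts_weightSimplex_two sylvesterPartition_two_mul (sylvesterPartition_pos 2 0) rfl
    ((Finset.range 4 ×ˢ Finset.range 4).filter fun p => p.1 + p.2 ≤ 3)
    fun p hp => by
      have := (Finset.mem_filter.1 hp).2
      simpa [Fin.sum_univ_three] using this

theorem le_numLatticePts_three :
    39 ≤ numLatticePts (weightSimplex (d := 3) ![3, 1, 1, 1]) :=
  numLatticePts_weightSimplex_three sylvesterPartition_three_mul (sylvesterPartition_pos 3 1) rfl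
    ((Finset.range 3 ×ˢ Finset.range 7 ×ˢ Finset.range 7).filter
      fun p => 3 * p.1 + p.2.1 + p.2.2 ≤ 6)
    fun p hp => by
      have := (Finset.mem_filter.1 hp).2
      simpa [Fin.sum_univ_four] using this

theorem le_numLatticePts_enlargedSylvester :
    39 ≤ numLatticePts (weightSimplex (enlargedSylvester 3)) :=
  numLatticePts_weightSimplex_three (sylvesterPartition_mul_enlargedSylvester (by norm_num))
    (sylvesterPartition_pos 3 2) rfl
    -- The box has sides `12 / q_i + 1`. The slices `p.1 = 0, 1, 2` contain `28 + 10 + 1 = 39`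
    -- points.
    ((Finset.range 3 ×ˢ Finset.range 4 ×ˢ Finset.range 13).filter
      fun p => 6 * p.1 + 4 * p.2.1 + p.2.2 ≤ 12)
    fun p hp => by
      have h1 := (Finset.mem_filter.1 hp).2
      rw [sum_enlargedSylvester (by norm_num)]
      have e0 : enlargedSylvester 3 0 = 6 := by decide
      have e1 : enlargedSylvester 3 1 = 4 := by decide
      have e2 : enlargedSylvester 3 2 = 1 := by decide
      have e3 : sylvesterT (3 - 1) = 6 := by decide
      rw [e0, e1, e2, e3, one_mul]
      exact h1

theorem theoremA :
    -- dimension 2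
    (IsReflexiveSimplex (weightSimplex (d := 2) ![1, 1, 1]) ∧
      ∀ P : Set (Fin 2 → ℝ), IsReflexiveSimplex P →
        (normalizedVolume P ≤ 9 ∧
          (normalizedVolume P = 9 ↔
            UnimodularlyEquivalent P (weightSimplex (d := 2) ![1, 1, 1]))) ∧
        (numLatticePts P ≤ 10 ∧
          (numLatticePts P = 10 ↔
            UnimodularlyEquivalent P (weightSimplex (d := 2) ![1, 1, 1])))) ∧
    -- dimension 3
    (IsReflexiveSimplex (weightSimplex (d := 3) ![3, 1, 1, 1]) ∧
      IsReflexiveSimplex (weightSimplex (enlargedSylvester 3)) ∧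
      ∀ P : Set (Fin 3 → ℝ), IsReflexiveSimplex P →
        (normalizedVolume P ≤ 72 ∧
          (normalizedVolume P = 72 ↔
            (UnimodularlyEquivalent P (weightSimplex (d := 3) ![3, 1, 1, 1]) ∨
              UnimodularlyEquivalent P (weightSimplex (enlargedSylvester 3))))) ∧
        (numLatticePts P ≤ 39 ∧
          (numLatticePts P = 39 ↔
            (UnimodularlyEquivalent P (weightSimplex (d := 3) ![3, 1, 1, 1]) ∨
              UnimodularlyEquivalent P (weightSimplex (enlargedSylvester 3)))))) ∧
    -- dimension at least 4
    (∀ d : ℕ, 4 ≤ d →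
      IsReflexiveSimplex (weightSimplex (enlargedSylvester d)) ∧
      ∀ P : Set (Fin d → ℝ), IsReflexiveSimplex P →
        normalizedVolume P ≤ 2 * (sylvesterT (d - 1) : ℝ) ^ 2 ∧
          (normalizedVolume P = 2 * (sylvesterT (d - 1) : ℝ) ^ 2 ↔
            UnimodularlyEquivalent P (weightSimplex (enlargedSylvester d)))) := by
  refine ⟨?_, ?_, fun d hd => ?_⟩
  · have hS : IsReflexiveSimplex (weightSimplex (d := 2) ![1, 1, 1]) :=
      isReflexiveSimplex_weightSimplex (d := 2) sylvesterPartition_two_mul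
        (sylvesterPartition_pos 2 0) rfl
    have hvol : normalizedVolume (weightSimplex (d := 2) ![1, 1, 1]) = 9 := by
      rw [normalizedVolume_weightSimplex (d := 2) sylvesterPartition_two_mul
        (sylvesterPartition_pos 2 0) rfl, prod_sylvesterPartition (by norm_num)]
      norm_num [sylvesterValue, sylvesterT_zero]
    have hnum : numLatticePts (weightSimplex (d := 2) ![1, 1, 1]) = 10 := by
      obtain ⟨D, -, hD, hN, -⟩ := hS.bounds_two
      exact le_antisymm (by omega) ten_le_numLatticePts
    refine ⟨hS, fun P hP => ?_⟩
    obtain ⟨D, hDv, hD, hN, he⟩ := hP.bounds_two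
    rw [← weightSimplex_eq (d := 2) sylvesterPartition_two_mul rfl] at he
    -- Ten lattice points force `D = 9`, as their number is at most `D + 1` and `D ≤ 9`.
    refine ⟨⟨?_, fun h => he ?_, fun h => h.normalizedVolume_eq.trans hvol⟩,
      by omega, fun h => he (by omega), fun h => h.numLatticePts_eq.trans hnum⟩
    · rw [hDv]; exact_mod_cast hD
    · rw [hDv] at h; exact_mod_cast h
  · have hS1 : IsReflexiveSimplex (weightSimplex (d := 3) ![3, 1, 1, 1]) :=
      isReflexiveSimplex_weightSimplex (d := 3) sylvesterPartition_three_mul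
        (sylvesterPartition_pos 3 1) rfl
    have hS2 : IsReflexiveSimplex (weightSimplex (enlargedSylvester 3)) :=
      isReflexiveSimplex_weightSimplex (sylvesterPartition_mul_enlargedSylvester (by norm_num))
        (sylvesterPartition_pos 3 2) rfl
    have hvol1 : normalizedVolume (weightSimplex (d := 3) ![3, 1, 1, 1]) = 72 := by
      rw [normalizedVolume_weightSimplex (d := 3) sylvesterPartition_three_mul
        (sylvesterPartition_pos 3 1) rfl, prod_sylvesterPartition (by norm_num),
        show sylvesterValue 3 1 = 72 by decide]
      norm_num
    have hvol2 : normalizedVolume (weightSimplex (enlargedSylvester 3)) = 72 := by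
      rw [normalizedVolume_weightSimplex (sylvesterPartition_mul_enlargedSylvester (by norm_num))
        (sylvesterPartition_pos 3 2) rfl, prod_sylvesterPartition (by norm_num),
        show sylvesterValue 3 2 = 72 by decide]
      norm_num
    have hnum1 : numLatticePts (weightSimplex (d := 3) ![3, 1, 1, 1]) = 39 := by
      obtain ⟨D, -, hD, hN, -⟩ := hS1.bounds_three
      exact le_antisymm (by omega) le_numLatticePts_three
    have hnum2 : numLatticePts (weightSimplex (enlargedSylvester 3)) = 39 := by
      obtain ⟨D, -, hD, hN, -⟩ := hS2.bounds_three
      exact le_antisymm (by omega) le_numLatticePts_enlargedSylvester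
    refine ⟨hS1, hS2, fun P hP => ?_⟩
    obtain ⟨D, hDv, hD, hN, he⟩ := hP.bounds_three
    rw [← weightSimplex_eq (d := 3) sylvesterPartition_three_mul rfl,
      ← weightSimplex_eq (sylvesterPartition_mul_enlargedSylvester (d := 3) (by norm_num)) rfl]
      at he
    -- Here `39` lattice points give `78 ≤ D + 6`, hence `D = 72`.
    refine ⟨⟨?_, fun h => he ?_, fun h => ?_⟩, by omega, fun h => he (by omega), fun h => ?_⟩
    · rw [hDv]; exact_mod_cast hD
    · rw [hDv] at h; exact_mod_cast h
    · rcases h with h | h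
      · exact h.normalizedVolume_eq.trans hvol1
      · exact h.normalizedVolume_eq.trans hvol2
    · rcases h with h | h
      · exact h.numLatticePts_eq.trans hnum1
      · exact h.numLatticePts_eq.trans hnum2
  · have hk := sylvesterPartition_mul_enlargedSylvester (d := d) (by omega)
    have hpos := sylvesterPartition_pos d (d - 1)
    have hlast := enlargedSylvester_last d
    refine ⟨isReflexiveSimplex_weightSimplex hk hpos hlast, fun P hP => ?_⟩
    obtain ⟨v, w, k, -, -, hvol, hle, heq⟩ := hP.exists_volume fun l hl => sylvesterValue_le hd hl
    rw [hvol]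
    refine ⟨by exact_mod_cast hle, fun h => ?_, fun h => ?_⟩
    · obtain ⟨l, hl, hv, he⟩ := heq (by exact_mod_cast h)
      obtain rfl : l = d - 1 := by
        by_contra hne
        have := sylvesterValue_lt hd hl hne
        rw [hv, sylvesterValue_sub_one (by omega)] at this
        exact lt_irrefl _ this
      rwa [weightSimplex_eq hk hlast]
    · rw [← hvol, h.normalizedVolume_eq, normalizedVolume_weightSimplex hk hpos hlast,
        prod_sylvesterPartition (by omega), sylvesterValue_sub_one (by omega)]
      push_cast
      rfl
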